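/- Let $U\subseteq\mathbf R^d$ be open, $\tau>0$, $\sigma>1$, $u\in\mathcal D'(U)$, and let $\Omega\subseteq U$ be open. Write $\widehat v(\xi)=\langle v,e^{-2\pi i x\xi}\rangle$ for $v\in\mathcal E'(U)$ (the strong dual of $C^\infty(U)$), and write $u\in\mathcal E_{\{\tau,\sigma\}}(\Omega)$ if $u$ coincides on $\Omega$ with a function $f\in C^\infty(\Omega)$ such that for every compact $K\subset\Omega$ there are $A,h>0$ with $$|\partial^\alpha f(x)|\le A\,h^{|\alpha|^\sigma}|\alpha|^{\tau|\alpha|^\sigma},\qquad x\in K,\ \alpha\in\mathbf N^d$$ (with $0^0=1$). (1) Sufficiency. If $\{u_N\}_{N\in\mathbf N}$ is a bounded sequence in $\mathcal E'(U)$ such that $u_N=u$ on $\Omega$ for all $N$ and, for some $A,h>0$, $$|\widehat u_N(\xi)|\le A\,\frac{h^N N!^{\tau/\sigma}}{|\xi|^{\lfloor N^{1/\sigma}\rfloor}},\qquad N\in\mathbf N,\ \xi\in\mathbf R^d\setminus\{0\},\tag{$*$}$$ then $u\in\mathcal E_{\{\tau,\sigma\}}(\Omega)$. (2) Necessity. Put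 $\tilde\tau=\tau^{\sigma/(\sigma-1)}$. Suppose that $u\in\mathcal E_{\{\tau,\sigma\}}(\Omega)$, let $K\subset\Omega$ be compact, and let $W$ be an open set whose closure is strictly contained in $K$. Let $\{\chi_N\}_{N\in\mathbf N}$ be a $\tilde\tau,\sigma$-admissible sequence with respect to $K$, that is: $\chi_N\in C^\infty(\mathbf R^d)$ has support in $K$ and equals $1$ in a neighbourhood of $W$ for every $N$, and there are positive constants $C_\beta$ ($\beta\in\mathbf N^d$) such that $$\sup_{x\in K}|\partial^{\alpha+\beta}\chi_N(x)|\le C_\beta^{|\alpha|+1}\lfloor N^{1/\sigma}\rfloor^{|\alpha|}\qquad\text{whenever } |\alpha|\le\lfloor (N/\tilde\tau)^{1/\sigma}\rfloor,\ N\in\mathbf N,\ \beta\in\mathbf N^d .$$ Then $\{\chi_N u\}_{N\in\mathbf N}$ is bounded in $\mathcal E'(U)$, $\chi_N u=u$ on $W$ for all $N$, and for some $A,h>0$ $$|\widehat{\chi_N u}(\xi)|\le A\,\frac{h^N N!^{\tilde\tau^{-1/\sigma}/\sigma}}{|\xi|^{\lfloor (N/\tilde\tau)^{1/\sigma}\rfloor}},\qquad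 N\in\mathbf N,\ \xi\in\mathbf R^d\setminus\{0\}.$$ Moreover, after the enumeration $N\to\tilde\tau N$, that is, for $u_N=\chi_{\lceil\tilde\tau N\rceil}u$, the estimate $(*)$ holds for some $A,h>0$. -/

import Mathlib

open TopologicalSpace MeasureTheory
open scoped Distributions ContDiff Topology

noncomputable section

/-- The Euclidean space `ℝ^d`. -/
abbrev Euc (d : ℕ) : Type := EuclideanSpace ℝ (Fin d)

/-- The length `|α| = α_1 + ⋯ + α_d` of a multi-index. -/
def mLen {d : ℕ} (α : Fin d → ℕ) : ℕ := ∑ i, α i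

/-- The partial derivative `∂^α f (x) = ∂_1^{α_1} ⋯ ∂_d^{α_d} f (x)`: the iterated derivative of
order `|α|`, evaluated on `α_1` copies of `e_1`, then `α_2` copies of `e_2`, and so on. -/
def mDeriv {d : ℕ} (α : Fin d → ℕ) (f : Euc d → ℂ) (x : Euc d) : ℂ :=
  iteratedFDeriv ℝ (mLen α) f x
    (fun k : Fin (∑ i, α i) => EuclideanSpace.single (finSigmaFinEquiv.symm k).1 (1 : ℝ))

/-! ### The space `C^∞(U)` with its Fréchet topology, and its strong dual `E'(U)` -/

/-- The complex vector space `C^∞(U)`. A smooth function on the open set `U` is represented by its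
extension by zero to `ℝ^d`. -/
def smoothSubmodule {d : ℕ} (U : Opens (Euc d)) : Submodule ℂ (Euc d → ℂ) where
  carrier := {f | ContDiffOn ℝ ∞ f U ∧ ∀ x, x ∉ U → f x = 0}
  add_mem' := fun {f g} hf hg =>
    ⟨hf.1.add hg.1, fun x hx => by simp [hf.2 x hx, hg.2 x hx]⟩
  zero_mem' := ⟨contDiffOn_const, fun _ _ => rfl⟩
  smul_mem' := fun c f hf =>
    ⟨hf.1.const_smul c, fun x hx => by simp [hf.2 x hx]⟩

/-- The space `C^∞(U)`, as a type of its own (it does not carry the topology of pointwise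
convergence). -/
def SmoothFn {d : ℕ} (U : Opens (Euc d)) : Type := smoothSubmodule U

namespace SmoothFn

variable {d : ℕ} {U : Opens (Euc d)}

instance : AddCommGroup (SmoothFn U) := inferInstanceAs (AddCommGroup (smoothSubmodule U))

instance : Module ℂ (SmoothFn U) := inferInstanceAs (Module ℂ (smoothSubmodule U))

instance : CoeFun (SmoothFn U) (fun _ => Euc d → ℂ) := ⟨fun f => f.1⟩

theorem contDiffAt (f : SmoothFn U) {x : Euc d} (hx : x ∈ U) : ContDiffAt ℝ ∞ (f : Euc d → ℂ) x :=
  f.2.1.contDiffAt (U.isOpen.mem_nhds hx)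

theorem continuousOn_iteratedFDeriv (f : SmoothFn U) (m : ℕ) :
    ContinuousOn (fun x => iteratedFDeriv ℝ m (f : Euc d → ℂ) x) U := fun x hx =>
  ((f.contDiffAt hx).continuousAt_iteratedFDeriv (by exact_mod_cast le_top)).continuousWithinAt

theorem bddAbove (f : SmoothFn U) {L : Compacts (Euc d)} (hL : (L : Set (Euc d)) ⊆ U) (m : ℕ) :
    BddAbove (Set.range fun x : L => ‖iteratedFDeriv ℝ m (f : Euc d → ℂ) x‖) := by
  have h := L.isCompact.bddAbove_image
    (((f.continuousOn_iteratedFDeriv m).mono hL).norm)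
  rwa [Set.image_eq_range] at h

/-- The seminorm `f ↦ sup_{x ∈ L} ‖D^m f (x)‖` on `C^∞(U)`, for `L ⊆ U` compact and `m ∈ ℕ`. -/
def seminorm (U : Opens (Euc d))
    (p : {L : Compacts (Euc d) // (L : Set (Euc d)) ⊆ U} × ℕ) : Seminorm ℂ (SmoothFn U) :=
  Seminorm.of (fun f => ⨆ x : p.1.1, ‖iteratedFDeriv ℝ p.2 (f : Euc d → ℂ) x‖)
    (fun f g => by
      refine Real.iSup_le (fun x => ?_) (add_nonneg
        (Real.iSup_nonneg fun _ => norm_nonneg _) (Real.iSup_nonneg fun _ => norm_nonneg _))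
      have hx : (x : Euc d) ∈ U := p.1.2 x.2
      have h : iteratedFDeriv ℝ p.2 ((f + g : SmoothFn U) : Euc d → ℂ) x =
          iteratedFDeriv ℝ p.2 (f : Euc d → ℂ) x + iteratedFDeriv ℝ p.2 (g : Euc d → ℂ) x :=
        iteratedFDeriv_add_apply ((f.contDiffAt hx).of_le (by exact_mod_cast le_top))
          ((g.contDiffAt hx).of_le (by exact_mod_cast le_top))
      rw [h]
      exact (norm_add_le _ _).trans
        (add_le_add (le_ciSup (f.bddAbove p.1.2 p.2) x) (le_ciSup (g.bddAbove p.1.2 p.2) x)))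
    (fun c f => by
      rw [Real.mul_iSup_of_nonneg (norm_nonneg c)]
      refine congrArg iSup (funext fun x => ?_)
      have hx : (x : Euc d) ∈ U := p.1.2 x.2
      have h : iteratedFDeriv ℝ p.2 ((c • f : SmoothFn U) : Euc d → ℂ) x =
          c • iteratedFDeriv ℝ p.2 (f : Euc d → ℂ) x :=
        iteratedFDeriv_const_smul_apply ((f.contDiffAt hx).of_le (by exact_mod_cast le_top))
      rw [h, norm_smul])

/-- The Fréchet topology of `C^∞(U)`: uniform convergence of all derivatives on compact sets. -/
instance : TopologicalSpace (SmoothFn U) :=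
  SeminormFamily.moduleFilterBasis (𝕜 := ℂ) (seminorm U) |>.topology

theorem withSeminorms (U : Opens (Euc d)) : WithSeminorms (seminorm U) := ⟨rfl⟩

instance : IsTopologicalAddGroup (SmoothFn U) := (withSeminorms U).topologicalAddGroup

instance : ContinuousSMul ℂ (SmoothFn U) := (withSeminorms U).continuousSMul

theorem le_seminorm (f : SmoothFn U) {L : Compacts (Euc d)} (hL : (L : Set (Euc d)) ⊆ U) (m : ℕ)
    {x : Euc d} (hx : x ∈ L) :
    ‖iteratedFDeriv ℝ m (f : Euc d → ℂ) x‖ ≤ seminorm U (⟨L, hL⟩, m) f :=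
  le_ciSup (f.bddAbove hL m) (⟨x, hx⟩ : L)

/-- A test function on `U`, regarded as an element of `C^∞(U)`. -/
def ofTest (φ : 𝓓(U, ℂ)) : SmoothFn U :=
  ⟨φ, φ.contDiff.contDiffOn, fun _ hx =>
    image_eq_zero_of_notMem_tsupport fun h => hx (φ.tsupport_subset h)⟩

/-- The restriction to `U` of the exponential `x ↦ exp (-2πi x·ξ)`. -/
def expFn (U : Opens (Euc d)) (ξ : Euc d) : SmoothFn U :=
  ⟨Set.indicator U fun x => Complex.exp (-(2 * Real.pi * inner ℝ x ξ : ℝ) * Complex.I), by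
    refine ContDiffOn.congr (ContDiff.contDiffOn ?_) fun x hx => Set.indicator_of_mem hx _
    have h : ContDiff ℝ ∞ fun x : Euc d => ((2 * Real.pi * inner ℝ x ξ : ℝ) : ℂ) :=
      Complex.ofRealCLM.contDiff.comp (contDiff_const.mul (contDiff_id.inner ℝ contDiff_const))
    exact (h.neg.mul contDiff_const).cexp,
    fun _ hx => Set.indicator_of_notMem hx _⟩

/-- The product `χ f`, for `χ ∈ C_c^∞(U)` and `f ∈ C^∞(U)`, is smooth on `ℝ^d`. -/
theorem contDiff_mul (χ : 𝓓(U, ℂ)) (f : SmoothFn U) :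
    ContDiff ℝ ∞ fun x => χ x * (f : Euc d → ℂ) x := by
  rw [contDiff_iff_contDiffAt]
  intro x
  by_cases hx : x ∈ U
  · exact χ.contDiff.contDiffAt.mul (f.contDiffAt hx)
  · have hx' : x ∉ tsupport χ := fun h => hx (χ.tsupport_subset h)
    refine (contDiffAt_const (c := (0 : ℂ))).congr_of_eventuallyEq ?_
    filter_upwards [notMem_tsupport_iff_eventuallyEq.1 hx'] with y hy
    simp [hy]

/-- The compact support of a test function. -/
def supp (χ : 𝓓(U, ℂ)) : Compacts (Euc d) := ⟨tsupport χ, χ.hasCompactSupport⟩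

/-- The linear map `f ↦ χ f` from `C^∞(U)` to the smooth functions supported in `supp χ`. -/
def mulLin (χ : 𝓓(U, ℂ)) : SmoothFn U →ₗ[ℂ] 𝓓_{supp χ}(Euc d, ℂ) where
  toFun f := ⟨fun x => χ x * (f : Euc d → ℂ) x, contDiff_mul χ f, fun x hx => by
    simp [image_eq_zero_of_notMem_tsupport (f := χ) hx]⟩
  map_add' f g := by
    ext x
    exact mul_add _ _ _
  map_smul' c f := by
    ext x
    exact mul_left_comm _ _ _

theorem continuous_mulLin (χ : 𝓓(U, ℂ)) : Continuous (mulLin χ) := by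
  refine WithSeminorms.continuous_of_isBounded (withSeminorms U)
    (ContDiffMapSupportedIn.withSeminorms ℂ (Euc d) ℂ ⊤ (supp χ)) _ (.of_real fun i => ?_)
  classical
  let s : Finset ({L : Compacts (Euc d) // (L : Set (Euc d)) ⊆ U} × ℕ) :=
    (Finset.range (i + 1)).image fun j => (⟨supp χ, χ.tsupport_subset⟩, j)
  have hB : ∀ j : ℕ, ∃ B : ℝ, ∀ x ∈ tsupport χ, ‖iteratedFDeriv ℝ j χ x‖ ≤ B := fun j => by
    obtain ⟨B, hB⟩ := χ.hasCompactSupport.isCompact.bddAbove_image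
      (χ.contDiff.continuous_iteratedFDeriv (m := j) (by exact_mod_cast le_top)).norm.continuousOn
    exact ⟨B, fun x hx => hB ⟨x, hx, rfl⟩⟩
  choose B hB using hB
  refine ⟨s, ∑ j ∈ Finset.range (i + 1), (i.choose j : ℝ) * |B j|, fun f => ?_⟩
  have hC : 0 ≤ ∑ j ∈ Finset.range (i + 1), (i.choose j : ℝ) * |B j| :=
    Finset.sum_nonneg fun j _ => by positivity
  refine (ContDiffMapSupportedIn.seminorm_top_le_iff ℂ (mul_nonneg hC (apply_nonneg _ _)) i _).2
    fun x hx => ?_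
  have hxU : x ∈ (U : Set (Euc d)) := χ.tsupport_subset hx
  have key := norm_iteratedFDerivWithin_mul_le (n := i) (N := ∞)
    (χ.contDiff.contDiffOn (s := (U : Set (Euc d)))) f.2.1
    U.isOpen.uniqueDiffOn hxU (by exact_mod_cast le_top)
  simp only [iteratedFDerivWithin_of_isOpen _ U.isOpen hxU] at key
  refine key.trans ?_
  rw [Finset.sum_mul]
  refine Finset.sum_le_sum fun j hj => ?_
  refine mul_le_mul (mul_le_mul_of_nonneg_left ((hB j x hx).trans (le_abs_self _))
    (Nat.cast_nonneg _)) ?_ (norm_nonneg _) (by positivity)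
  refine (le_seminorm f (L := supp χ) χ.tsupport_subset (i - j) hx).trans ?_
  have hmem : ((⟨supp χ, χ.tsupport_subset⟩, i - j) :
      {L : Compacts (Euc d) // (L : Set (Euc d)) ⊆ U} × ℕ) ∈ s :=
    Finset.mem_image_of_mem _ (Finset.mem_range.2 (Nat.lt_succ_of_le (Nat.sub_le i j)))
  exact Seminorm.le_finset_sup_apply hmem

/-- Multiplication by a test function `χ`, as a continuous linear map from `C^∞(U)` to the space of
test functions. -/
def mulTest (χ : 𝓓(U, ℂ)) : SmoothFn U →L[ℂ] 𝓓(U, ℂ) :=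
  (TestFunction.ofSupportedInCLM ℂ (K := supp χ) χ.tsupport_subset).comp
    ⟨mulLin χ, continuous_mulLin χ⟩

theorem mulTest_apply (χ : 𝓓(U, ℂ)) (f : SmoothFn U) (x : Euc d) :
    mulTest χ f x = χ x * (f : Euc d → ℂ) x := rfl

end SmoothFn

/-- The Schwartz distributions `D'(U)`: continuous linear forms on complex test functions. -/
abbrev Distr {d : ℕ} (U : Opens (Euc d)) : Type := 𝓓(U, ℂ) →L[ℂ] ℂ

/-- The compactly supported distributions `E'(U)`: the dual of `C^∞(U)`, with its strong topology
(uniform convergence on the bounded subsets of `C^∞(U)`). -/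
abbrev CDistr {d : ℕ} (U : Opens (Euc d)) : Type := SmoothFn U →L[ℂ] ℂ

/-- The sequence `v` is bounded in `E'(U)`. -/
def BoundedSeq {d : ℕ} {U : Opens (Euc d)} (v : ℕ → CDistr U) : Prop :=
  Bornology.IsVonNBounded ℂ (Set.range v)

/-- The Fourier transform `v̂(ξ) = ⟨v, exp (-2πi x·ξ)⟩` of a compactly supported distribution. -/
def CDistr.fourier {d : ℕ} {U : Opens (Euc d)} (v : CDistr U) (ξ : Euc d) : ℂ :=
  v (SmoothFn.expFn U ξ)

/-- `v = u` on the open set `Ω`. -/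
def CDistr.EqOn {d : ℕ} {U : Opens (Euc d)} (v : CDistr U) (u : Distr U) (Ω : Opens (Euc d)) :
    Prop :=
  ∀ φ : 𝓓(U, ℂ), tsupport φ ⊆ Ω → v (SmoothFn.ofTest φ) = u φ

/-- The product `χ u ∈ E'(U)` of a distribution `u ∈ D'(U)` and a test function `χ`:
`⟨χ u, f⟩ = ⟨u, χ f⟩`. -/
def Distr.cutoff {d : ℕ} {U : Opens (Euc d)} (χ : 𝓓(U, ℂ)) (u : Distr U) : CDistr U :=
  u.comp (SmoothFn.mulTest χ)

/-! ### The classes `E_{τ,σ}` -/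

/-- The function `f` belongs to the (Roumieu) class `E_{τ,σ}(Ω)`. -/
def IsRegularFun {d : ℕ} (τ σ : ℝ) (Ω : Opens (Euc d)) (f : Euc d → ℂ) : Prop :=
  ContDiffOn ℝ ∞ f Ω ∧
    ∀ K : Set (Euc d), IsCompact K → K ⊆ Ω → ∃ A h : ℝ, 0 < A ∧ 0 < h ∧
      ∀ (α : Fin d → ℕ), ∀ x ∈ K,
        ‖mDeriv α f x‖ ≤
          A * h ^ ((mLen α : ℝ) ^ σ) * (mLen α : ℝ) ^ (τ * (mLen α : ℝ) ^ σ)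

/-- The distribution `u ∈ D'(U)` belongs to `E_{τ,σ}(Ω)`, for `Ω ⊆ U` open: its restriction to `Ω`
is given by a function of that class. -/
def Distr.IsRegularOn {d : ℕ} {U : Opens (Euc d)} (u : Distr U) (τ σ : ℝ) (Ω : Opens (Euc d)) :
    Prop :=
  ∃ f : Euc d → ℂ, IsRegularFun τ σ Ω f ∧
    ∀ φ : 𝓓(U, ℂ), tsupport φ ⊆ Ω → u φ = ∫ x, f x * φ x

/-! ### Admissible sequences of cut-off functions -/

/-- The sequence `χ_N ∈ C^∞_K` is `τ,σ`-admissible with respect to the compact set `K ⊆ U`, and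
equal to `1` near the set `W`, whose closure is strictly contained in `K`. -/
structure IsAdmissible {d : ℕ} {U : Opens (Euc d)} (τ σ : ℝ) (W K : Set (Euc d))
    (χ : ℕ → 𝓓(U, ℂ)) : Prop where
  isCompact : IsCompact K
  subset : K ⊆ U
  closure_ssubset : closure W ⊂ K
  tsupport_subset : ∀ N, tsupport (χ N) ⊆ K
  eq_one : ∀ N, ∀ᶠ x in 𝓝ˢ W, χ N x = 1
  bound : ∃ C : (Fin d → ℕ) → ℝ, (∀ β, 0 < C β) ∧
    ∀ (N : ℕ) (α β : Fin d → ℕ), mLen α ≤ ⌊((N : ℝ) / τ) ^ (1 / σ)⌋₊ → ∀ x ∈ K,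
      ‖mDeriv (α + β) (χ N) x‖ ≤
        C β ^ (mLen α + 1) * (⌊(N : ℝ) ^ (1 / σ)⌋₊ : ℝ) ^ mLen α

end

/-!
Both halves rest on one bookkeeping identity: if `n` is about `N^{1/σ}`, then `n^{τ n^σ}` and
`N!^{τ/σ}` agree up to a factor `h^N`.

*Sufficiency.* A compactly supported distribution `v` with integrable Fourier transform is the
function `𝓕⁻ v̂` on `U` (`CDistr.apply_ofTest_eq_integral_fourierInv`). The only delicate point is the
exchange of `v` with the integral `φ = ∫ ψ(ξ) e^{-2πi x·ξ} dξ`. Continuity of `v` bounds it by finitely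
many derivatives on compact sets, so by Hahn–Banach `v` factors through a finite product of Banach
spaces `C(L, ·)` of jets (`SmoothFn.exists_eq_clm_jet`), and there the exchange is the commutation of
a continuous linear form with a Bochner integral. Hence on `Ω` the distribution `u` is given by
`F_n = 𝓕⁻ v̂_N` for each `N = ⌈(n + d + 1)^σ⌉`. The decay of order `n + d + 1` makes `F_n` of class
`C^n`, with derivatives of order `n` bounded by a constant times `(2π)^n h^N N!^{τ/σ}`; the
frequencies `|ξ| ≤ 1` are controlled by the boundedness of the sequence. All `F_n` agree on `Ω`, and
since `N = n^σ + O(n^{σ-1})` the bound has the required form (`exists_pow_mul_factorial_rpow_le`).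

*Necessity.* Now `χ_M u` is the smooth function `f χ_M`, supported in `K`. Integrating by parts `n`
times in the direction of the largest coordinate of `ξ`, where `n` is an order up to which `χ_M` is
controlled, and applying the Leibniz rule gives a bound by `h^{n^σ} n^{τ n^σ} C^n ⌊M^{1/σ}⌋^n`
(`exists_pow_mul_norm_fourier_cutoff_le`). For `n^σ ≤ c N` and `M = O(N)` this is at most
`H^N N!^{τ c/σ}` (`exists_le_pow_mul_factorial_rpow`). The two estimates are the cases
`M = N`, `c = 1/τ'` and `M = ⌈τ' N⌉`, `c = 1`.
-/

noncomputable section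

open scoped FourierTransform RealInnerProductSpace

/-! ### Continuous linear forms on `C^∞(U)` and jets -/

/-- A linear form that is dominated by the norm of a linear image factors through that image, by a
continuous linear form (Hahn–Banach). -/
theorem exists_clm_apply_eq {E F : Type*} [AddCommGroup E] [Module ℂ E] [NormedAddCommGroup F]
    [NormedSpace ℂ F] (J : E →ₗ[ℂ] F) (v : E →ₗ[ℂ] ℂ) (C : ℝ) (h : ∀ f, ‖v f‖ ≤ C * ‖J f‖) :
    ∃ Λ : F →L[ℂ] ℂ, ∀ f, Λ (J f) = v f := by
  obtain ⟨r, hr⟩ := J.rangeRestrict.exists_rightInverse_of_surjective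
    (LinearMap.range_eq_top.2 J.surjective_rangeRestrict)
  have hr' : ∀ y : LinearMap.range J, J (r y) = y := fun y =>
    congrArg Subtype.val (LinearMap.congr_fun hr y)
  obtain ⟨Λ, hΛ, -⟩ := exists_extension_norm_eq (LinearMap.range J)
    ((v ∘ₗ r).mkContinuous C fun y => by
      simpa [hr' y] using h (r y))
  refine ⟨Λ, fun f => ?_⟩
  have h1 : Λ (J f) = v (r ⟨J f, LinearMap.mem_range_self J f⟩) :=
    hΛ ⟨J f, LinearMap.mem_range_self J f⟩
  rw [h1, ← sub_eq_zero, ← map_sub, ← norm_le_zero_iff]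
  refine (h _).trans ?_
  simp [hr']

/-- The Banach space of `m`-linear forms on `ℝ^d`. It is a type of its own, so that the norm is the
only source of its topology. -/
def MForm (d m : ℕ) : Type := ContinuousMultilinearMap ℝ (fun _ : Fin m => Euc d) ℂ

namespace MForm

variable {d m : ℕ}

instance : NormedAddCommGroup (MForm d m) :=
  inferInstanceAs (NormedAddCommGroup (ContinuousMultilinearMap ℝ (fun _ : Fin m => Euc d) ℂ))

instance : NormedSpace ℂ (MForm d m) :=
  inferInstanceAs (NormedSpace ℂ (ContinuousMultilinearMap ℝ (fun _ : Fin m => Euc d) ℂ))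

instance : CompleteSpace (MForm d m) :=
  inferInstanceAs (CompleteSpace (ContinuousMultilinearMap ℝ (fun _ : Fin m => Euc d) ℂ))

end MForm

/-- The polynomial `ξ ↦ (-2πi)^m ⟪ξ, ·⟫ ⋯ ⟪ξ, ·⟫` with values in the `m`-linear forms: the symbol of
the `m`-th derivative. -/
def derivSymbol (d m : ℕ) (ξ : Euc d) : MForm d m :=
  VectorFourier.fourierPowSMulRight (innerSL ℝ) (fun _ : Euc d => (1 : ℂ)) ξ m

theorem continuous_derivSymbol (d m : ℕ) : Continuous (derivSymbol d m) :=
  Continuous.fourierPowSMulRight (innerSL ℝ) continuous_const m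

theorem norm_derivSymbol_le {d : ℕ} (m : ℕ) (ξ : Euc d) :
    ‖derivSymbol d m ξ‖ ≤ (2 * Real.pi) ^ m * ‖ξ‖ ^ m := by
  refine (VectorFourier.norm_fourierPowSMulRight_le _ _ _ _).trans ?_
  have := norm_innerSL_le (E := Euc d) ℝ
  have h2 : 2 * Real.pi * ‖innerSL (E := Euc d) ℝ‖ ≤ 2 * Real.pi :=
    mul_le_of_le_one_right (by positivity) this
  rw [norm_one, mul_one]
  gcongr

theorem fourierPowSMulRight_eq_smul_derivSymbol {d : ℕ} (g : Euc d → ℂ) (m : ℕ) (ξ : Euc d) :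
    (VectorFourier.fourierPowSMulRight (innerSL ℝ) g ξ m : MForm d m) = g ξ • derivSymbol d m ξ := by
  refine ContinuousMultilinearMap.ext fun w => ?_
  change _ = g ξ • VectorFourier.fourierPowSMulRight (innerSL ℝ) (fun _ : Euc d => (1 : ℂ)) ξ m w
  simp only [VectorFourier.fourierPowSMulRight_apply, smul_eq_mul, Complex.real_smul]
  ring

/-- The derivatives of a character, obtained from those of the Fourier transform of a Dirac mass. -/
theorem iteratedFDeriv_fourierChar {d : ℕ} (m : ℕ) (ξ x : Euc d) :
    iteratedFDeriv ℝ m (fun y : Euc d => (Real.fourierChar (-⟪ξ, y⟫) : ℂ)) x =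
      (Real.fourierChar (-⟪ξ, x⟫) : ℂ) • derivSymbol d m ξ := by
  have h := VectorFourier.iteratedFDeriv_fourierIntegral (N := ⊤) (n := m)
    (μ := Measure.dirac ξ) (innerSL ℝ : Euc d →L[ℝ] Euc d →L[ℝ] ℝ) (f := fun _ => (1 : ℂ))
    (fun n _ => integrable_dirac (by simp)) aestronglyMeasurable_const le_top
  have h' := congrFun h x
  have h1 : VectorFourier.fourierIntegral Real.fourierChar (Measure.dirac ξ)
      (innerSL ℝ : Euc d →L[ℝ] Euc d →L[ℝ] ℝ).toLinearMap₁₂ (fun _ => (1 : ℂ)) =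
      fun y : Euc d => (Real.fourierChar (-⟪ξ, y⟫) : ℂ) := by
    ext1 y
    simp [VectorFourier.fourierIntegral, Circle.smul_def]
  rw [h1] at h'
  rw [h', VectorFourier.fourierIntegral, integral_dirac]
  rfl

namespace SmoothFn

variable {d : ℕ} {U : Opens (Euc d)}

/-- The `m`-th derivative restricted to a compact set `L ⊆ U`, with values in the Banach space of
continuous functions on `L`. -/
def jet (U : Opens (Euc d)) (p : {L : Compacts (Euc d) // (L : Set (Euc d)) ⊆ U} × ℕ) :
    SmoothFn U →ₗ[ℂ] C(p.1.1, MForm d p.2) where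
  toFun f := ⟨fun x => iteratedFDeriv ℝ p.2 (f : Euc d → ℂ) x,
    ((f.continuousOn_iteratedFDeriv p.2).mono p.1.2).domRestrict⟩
  map_add' f g := by
    ext1 x
    exact iteratedFDeriv_add_apply ((f.contDiffAt (p.1.2 x.2)).of_le (by exact_mod_cast le_top))
          ((g.contDiffAt (p.1.2 x.2)).of_le (by exact_mod_cast le_top))
  map_smul' c f := by
    ext1 x
    exact iteratedFDeriv_const_smul_apply
      ((f.contDiffAt (p.1.2 x.2)).of_le (by exact_mod_cast le_top))

theorem jet_apply (p : {L : Compacts (Euc d) // (L : Set (Euc d)) ⊆ U} × ℕ) (f : SmoothFn U)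
    (x : p.1.1) : jet U p f x = iteratedFDeriv ℝ p.2 (f : Euc d → ℂ) x := rfl

theorem seminorm_le_norm_jet (p : {L : Compacts (Euc d) // (L : Set (Euc d)) ⊆ U} × ℕ)
    (f : SmoothFn U) : seminorm U p f ≤ ‖jet U p f‖ :=
  Real.iSup_le (fun x => (jet U p f).norm_coe_le_norm x) (norm_nonneg _)

/-- Every continuous linear form on `C^∞(U)` depends on finitely many derivatives on compact sets
only, and continuously so in the uniform norm. -/
theorem exists_eq_clm_jet (v : SmoothFn U →L[ℂ] ℂ) :
    ∃ (s : Finset ({L : Compacts (Euc d) // (L : Set (Euc d)) ⊆ U} × ℕ))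
      (Λ : (∀ p : s, C(p.1.1.1, MForm d p.1.2)) →L[ℂ] ℂ),
      ∀ f, v f = Λ fun p => jet U p.1 f := by
  obtain ⟨s, C, -, hC⟩ := Seminorm.bound_of_continuous (withSeminorms U)
    ((normSeminorm ℂ ℂ).comp v.toLinearMap) (continuous_norm.comp v.continuous)
  obtain ⟨Λ, hΛ⟩ := exists_clm_apply_eq (LinearMap.pi fun p : s => jet U p.1) v.toLinearMap C
    fun f => by
      refine (hC f).trans ?_
      rw [smul_apply, NNReal.smul_def, smul_eq_mul]
      refine mul_le_mul_of_nonneg_left ?_ C.2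
      refine Seminorm.finset_sup_apply_le (norm_nonneg _) fun p hp => ?_
      exact (seminorm_le_norm_jet p f).trans
        (norm_le_pi_norm (LinearMap.pi (fun p : s => jet U p.1) f) ⟨p, hp⟩)
  exact ⟨s, Λ, fun f => (hΛ f).symm⟩

theorem iteratedFDeriv_expFn (m : ℕ) (ξ : Euc d) {x : Euc d} (hx : x ∈ U) :
    iteratedFDeriv ℝ m (expFn U ξ : Euc d → ℂ) x =
      (Real.fourierChar (-⟪ξ, x⟫) : ℂ) • derivSymbol d m ξ := by
  rw [← iteratedFDeriv_fourierChar]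
  suffices h : (expFn U ξ : Euc d → ℂ) =ᶠ[𝓝 x] fun y => (Real.fourierChar (-⟪ξ, y⟫) : ℂ) from
    (h.iteratedFDeriv ℝ m).eq_of_nhds
  filter_upwards [U.isOpen.mem_nhds hx] with y hy
  rw [Real.fourierChar_apply, real_inner_comm]
  have e : (expFn U ξ : Euc d → ℂ) y =
      Complex.exp (-(2 * Real.pi * inner ℝ y ξ : ℝ) * Complex.I) :=
    Set.indicator_of_mem hy fun y => Complex.exp (-(2 * Real.pi * inner ℝ y ξ : ℝ) * Complex.I)
  rw [e]
  push_cast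
  ring_nf

theorem continuous_jet_expFn (p : {L : Compacts (Euc d) // (L : Set (Euc d)) ⊆ U} × ℕ) :
    Continuous fun ξ : Euc d => jet U p (expFn U ξ) := by
  refine ContinuousMap.continuous_of_continuous_uncurry _ ?_
  have : (Function.uncurry fun (ξ : Euc d) (x : p.1.1) => jet U p (expFn U ξ) x) =
      fun q : Euc d × p.1.1 => (Real.fourierChar (-⟪q.1, (q.2 : Euc d)⟫) : ℂ) • derivSymbol d p.2 q.1 := by
    ext1 q
    exact iteratedFDeriv_expFn _ _ (p.1.2 q.2.2)
  rw [this]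
  have h1 := (continuous_derivSymbol d p.2)
  have h2 := Real.continuous_fourierChar
  fun_prop

theorem norm_jet_expFn_le (p : {L : Compacts (Euc d) // (L : Set (Euc d)) ⊆ U} × ℕ) (ξ : Euc d) :
    ‖jet U p (expFn U ξ)‖ ≤ (2 * Real.pi) ^ p.2 * ‖ξ‖ ^ p.2 := by
  refine (ContinuousMap.norm_le _ (by positivity)).2 fun x => ?_
  rw [jet_apply, iteratedFDeriv_expFn _ _ (p.1.2 x.2), norm_smul, Circle.norm_coe, one_mul]
  exact norm_derivSymbol_le _ _

theorem seminorm_expFn_le (p : {L : Compacts (Euc d) // (L : Set (Euc d)) ⊆ U} × ℕ) (ξ : Euc d) :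
    seminorm U p (expFn U ξ) ≤ (2 * Real.pi) ^ p.2 * ‖ξ‖ ^ p.2 :=
  (seminorm_le_norm_jet p _).trans (norm_jet_expFn_le p ξ)

theorem integrable_smul_jet_expFn (p : {L : Compacts (Euc d) // (L : Set (Euc d)) ⊆ U} × ℕ)
    (ψ : SchwartzMap (Euc d) ℂ) : Integrable fun ξ : Euc d => ψ ξ • jet U p (expFn U ξ) := by
  refine ((ψ.integrable_pow_mul volume p.2).const_mul ((2 * Real.pi) ^ p.2)).mono'
    (ψ.continuous.smul (continuous_jet_expFn p)).aestronglyMeasurable (.of_forall fun ξ => ?_)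
  rw [norm_smul]
  refine (mul_le_mul_of_nonneg_left (norm_jet_expFn_le p ξ) (norm_nonneg _)).trans_eq ?_
  ring

/-- Differentiated Fourier inversion: the jet of a test function is a superposition of the jets of
the exponentials. -/
theorem jet_ofTest (p : {L : Compacts (Euc d) // (L : Set (Euc d)) ⊆ U} × ℕ) (φ : 𝓓(U, ℂ))
    (ψ : SchwartzMap (Euc d) ℂ) (hψ : 𝓕 (ψ : Euc d → ℂ) = φ) :
    jet U p (ofTest φ) = ∫ ξ, ψ ξ • jet U p (expFn U ξ) := by
  ext1 x
  have hx : (x : Euc d) ∈ U := p.1.2 x.2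
  have h1 := (ContinuousMap.evalCLM ℂ x).integral_comp_comm (integrable_smul_jet_expFn p ψ)
  simp only [ContinuousMap.evalCLM_apply] at h1
  rw [← h1, jet_apply]
  change iteratedFDeriv ℝ p.2 φ x = _
  rw [← hψ, Real.iteratedFDeriv_fourier (N := ⊤) (fun n _ => ψ.integrable_pow_mul volume n)
    ψ.continuous.aestronglyMeasurable le_top, Real.fourier_eq]
  refine integral_congr_ae (.of_forall fun ξ => ?_)
  simp only [fourierPowSMulRight_eq_smul_derivSymbol]
  rw [ContinuousMap.smul_apply, jet_apply, iteratedFDeriv_expFn _ _ hx, smul_comm]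
  rfl

end SmoothFn

/-! ### Fourier inversion for compactly supported distributions -/

namespace CDistr

variable {d : ℕ} {U : Opens (Euc d)}

theorem continuous_fourier (v : CDistr U) : Continuous v.fourier := by
  obtain ⟨s, Λ, hΛ⟩ := SmoothFn.exists_eq_clm_jet v
  have : v.fourier = fun ξ => Λ fun p => SmoothFn.jet U p.1 (SmoothFn.expFn U ξ) :=
    funext fun ξ => hΛ _
  rw [this]
  exact Λ.continuous.comp (continuous_pi fun p => SmoothFn.continuous_jet_expFn p.1)

theorem apply_ofTest_eq_integral (v : CDistr U) (φ : 𝓓(U, ℂ)) (ψ : SchwartzMap (Euc d) ℂ)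
    (hψ : 𝓕 (ψ : Euc d → ℂ) = φ) :
    v (SmoothFn.ofTest φ) = ∫ ξ, ψ ξ * v.fourier ξ := by
  obtain ⟨s, Λ, hΛ⟩ := SmoothFn.exists_eq_clm_jet v
  have hint : Integrable fun ξ : Euc d =>
      fun p : s => ψ ξ • SmoothFn.jet U p.1 (SmoothFn.expFn U ξ) :=
    Integrable.of_eval fun p => SmoothFn.integrable_smul_jet_expFn p.1 ψ
  have h1 : (fun p : s => SmoothFn.jet U p.1 (SmoothFn.ofTest φ)) =
      ∫ ξ, fun p : s => ψ ξ • SmoothFn.jet U p.1 (SmoothFn.expFn U ξ) := by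
    ext1 p
    rw [SmoothFn.jet_ofTest p.1 φ ψ hψ, eval_integral]
    exact fun p => SmoothFn.integrable_smul_jet_expFn p.1 ψ
  rw [hΛ, h1, ← Λ.integral_comp_comm hint]
  refine integral_congr_ae (.of_forall fun ξ => ?_)
  change Λ (ψ ξ • fun p : s => SmoothFn.jet U p.1 (SmoothFn.expFn U ξ)) = _
  rw [map_smul, smul_eq_mul, ← hΛ]
  rfl

/-- A compactly supported distribution with integrable Fourier transform is the function given by
Fourier inversion. -/
theorem apply_ofTest_eq_integral_fourierInv (v : CDistr U) (hv : Integrable v.fourier)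
    (φ : 𝓓(U, ℂ)) : v (SmoothFn.ofTest φ) = ∫ x, 𝓕⁻ v.fourier x * φ x := by
  let φ' : SchwartzMap (Euc d) ℂ := φ.hasCompactSupport.toSchwartzMap φ.contDiff
  have hφ : ((𝓕⁻ φ' : SchwartzMap (Euc d) ℂ) : Euc d → ℂ) = 𝓕⁻ (φ : Euc d → ℂ) := by
    rw [SchwartzMap.fourierInv_coe]; rfl
  have h1 : 𝓕 ((𝓕⁻ φ' : SchwartzMap (Euc d) ℂ) : Euc d → ℂ) = φ := by
    rw [← SchwartzMap.fourier_coe, FourierTransform.fourier_fourierInv_eq]; rfl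
  rw [apply_ofTest_eq_integral v φ _ h1]
  have h2 : (-innerₗ (Euc d)).flip = -innerₗ (Euc d) := by
    ext x y
    simp [real_inner_comm]
  have hc : Continuous fun p : Euc d × Euc d => -⟪p.1, p.2⟫ := by fun_prop
  have h := VectorFourier.integral_fourierIntegral_smul_eq_flip (e := Real.fourierChar)
    (μ := (volume : Measure (Euc d))) (ν := volume) (L := -innerₗ (Euc d)) (f := (φ : Euc d → ℂ))
    (g := v.fourier) Real.continuous_fourierChar
    hc φ'.integrable hv
  rw [h2] at h
  simp only [smul_eq_mul] at h
  rw [hφ]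
  refine h.trans (integral_congr_ae (.of_forall fun x => mul_comm _ _))

end CDistr

/-! ### Comparison of the growth in `n` with the growth in `N` -/

/-- The lower bound `N^N ≤ e^N N!`, in logarithmic form. -/
theorem mul_log_le_log_factorial_add (N : ℕ) : N * Real.log N ≤ Real.log N.factorial + N := by
  rcases N.eq_zero_or_pos with rfl | hN
  · simp
  have hN' : (0 : ℝ) < N := by exact_mod_cast hN
  have hf : (0 : ℝ) < N.factorial := by exact_mod_cast N.factorial_pos
  have h := Real.pow_div_factorial_le_exp (N : ℝ) hN'.le N
  rw [div_le_iff₀ hf] at h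
  have h2 := Real.log_le_log (by positivity) h
  rw [Real.log_pow, Real.log_mul (Real.exp_pos _).ne' hf.ne', Real.log_exp] at h2
  linarith

theorem log_factorial_le_mul_log (N : ℕ) : Real.log N.factorial ≤ N * Real.log N := by
  rw [← Real.log_pow]
  exact Real.log_le_log (by exact_mod_cast N.factorial_pos) (by exact_mod_cast N.factorial_le_pow)

/-- The increment of `x ↦ x^σ` over a fixed step is `O(x^{σ-1})`, by Bernoulli's inequality. -/
theorem add_rpow_le_add_mul_rpow {σ : ℝ} (hσ : 1 < σ) {x k : ℝ} (hx : 1 ≤ x) (hk : 0 ≤ k) :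
    (x + k) ^ σ ≤ x ^ σ + σ * k * (k + 1) ^ (σ - 1) * x ^ (σ - 1) := by
  have hxk : 0 < x + k := by linarith
  have h1 := one_add_mul_self_le_rpow_one_add (s := -(k / (x + k))) (p := σ)
    (by rw [neg_le_neg_iff, div_le_one hxk]; linarith) hσ.le
  have h2 : 1 + -(k / (x + k)) = x / (x + k) := by field_simp; ring
  rw [h2, Real.div_rpow (by linarith) hxk.le, le_div_iff₀ (by positivity)] at h1
  have h3 : (x + k) ^ σ = (x + k) ^ (σ - 1) * (x + k) := by
    rw [← Real.rpow_add_one hxk.ne', sub_add_cancel]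
  have h4 : (x + k) ^ (σ - 1) ≤ (k + 1) ^ (σ - 1) * x ^ (σ - 1) := by
    rw [← Real.mul_rpow (by linarith) (by linarith)]
    refine Real.rpow_le_rpow hxk.le ?_ (by linarith)
    nlinarith
  have h5 : (1 + σ * -(k / (x + k))) * (x + k) ^ σ = (x + k) ^ σ - σ * k * (x + k) ^ (σ - 1) := by
    rw [h3]; field_simp; ring
  rw [h5] at h1
  have h6 := mul_le_mul_of_nonneg_left h4 (by positivity : 0 ≤ σ * k)
  linarith

/-- The order `N = ⌈(n + k)^σ⌉` exceeds `n^σ` by at most a multiple of `n^{σ-1}`, so that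
`N log N` exceeds `σ n^σ log n` by at most a multiple of `n^σ`. -/
theorem exists_ceil_rpow_mul_log_le {σ : ℝ} (hσ : 1 < σ) (k : ℕ) :
    ∃ C : ℝ, 0 ≤ C ∧ ∀ n : ℕ, 1 ≤ n →
      (⌈((n + k : ℕ) : ℝ) ^ σ⌉₊ : ℝ) ≤ C * (n : ℝ) ^ σ ∧
      (⌈((n + k : ℕ) : ℝ) ^ σ⌉₊ : ℝ) * Real.log ⌈((n + k : ℕ) : ℝ) ^ σ⌉₊ ≤
        σ * (n : ℝ) ^ σ * Real.log n + C * (n : ℝ) ^ σ := by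
  set D : ℝ := σ * k * (k + 1) ^ (σ - 1) + 1 with hD
  have hD1 : 1 ≤ D := le_add_of_nonneg_left (by positivity)
  set c : ℝ := 1 + D with hc
  have hlc : 0 ≤ Real.log c := Real.log_nonneg (by linarith)
  refine ⟨c + (c * Real.log c + σ * D), by positivity, fun n hn => ?_⟩
  have hn1 : (1 : ℝ) ≤ n := by exact_mod_cast hn
  have hn0 : (0 : ℝ) < n := by linarith
  set N : ℕ := ⌈((n + k : ℕ) : ℝ) ^ σ⌉₊ with hN
  have hp1 : 1 ≤ (n : ℝ) ^ (σ - 1) := Real.one_le_rpow hn1 (by linarith)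
  have hpp : (n : ℝ) ^ (σ - 1) * n = (n : ℝ) ^ σ := by
    rw [← Real.rpow_add_one hn0.ne', sub_add_cancel]
  have hp2 : (n : ℝ) ^ (σ - 1) ≤ (n : ℝ) ^ σ := by nlinarith
  have hNle : (N : ℝ) ≤ (n : ℝ) ^ σ + D * (n : ℝ) ^ (σ - 1) := by
    have h1 : (N : ℝ) < ((n + k : ℕ) : ℝ) ^ σ + 1 := Nat.ceil_lt_add_one (by positivity)
    have h2 := add_rpow_le_add_mul_rpow hσ hn1 (Nat.cast_nonneg k)
    push_cast at h1
    rw [hD]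
    linarith
  have hNc : (N : ℝ) ≤ c * (n : ℝ) ^ σ := by
    rw [hc]; nlinarith
  have hN1 : (1 : ℝ) ≤ N := by
    have : 1 ≤ ((n + k : ℕ) : ℝ) ^ σ := 
      Real.one_le_rpow (by push_cast; linarith [Nat.cast_nonneg (α := ℝ) k]) (by linarith)
    exact this.trans (Nat.le_ceil _)
  have hlog : Real.log N ≤ Real.log c + σ * Real.log n := by
    rw [← Real.log_rpow hn0, ← Real.log_mul (by positivity) (by positivity)]
    exact Real.log_le_log (by linarith) hNc
  have hln : 0 ≤ Real.log n := Real.log_nonneg hn1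
  have hln2 : Real.log n ≤ n := (Real.log_le_sub_one_of_pos hn0).trans (by linarith)
  have hns : 0 ≤ (n : ℝ) ^ σ := by positivity
  constructor
  · refine hNc.trans (mul_le_mul_of_nonneg_right ?_ hns)
    have : 0 ≤ c * Real.log c + σ * D := by positivity
    linarith
  · have h1 : (N : ℝ) * Real.log N ≤ N * Real.log c + σ * (N * Real.log n) := by
      have := mul_le_mul_of_nonneg_left hlog (by linarith : (0 : ℝ) ≤ N)
      linarith
    have h2 : (N : ℝ) * Real.log c ≤ c * (n : ℝ) ^ σ * Real.log c :=
      mul_le_mul_of_nonneg_right hNc hlc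
    have h3 : (N : ℝ) * Real.log n ≤ (n : ℝ) ^ σ * Real.log n + D * (n : ℝ) ^ σ := by
      have h4 := mul_le_mul_of_nonneg_right hNle hln
      have h5 : D * (n : ℝ) ^ (σ - 1) * Real.log n ≤ D * (n : ℝ) ^ (σ - 1) * n :=
        mul_le_mul_of_nonneg_left hln2 (by positivity)
      rw [mul_assoc D _ (n : ℝ), hpp] at h5
      linarith
    have h6 : σ * (N * Real.log n) ≤ σ * ((n : ℝ) ^ σ * Real.log n + D * (n : ℝ) ^ σ) :=
      mul_le_mul_of_nonneg_left h3 (by linarith)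
    have h7 : 0 ≤ c * (n : ℝ) ^ σ := by positivity
    nlinarith

/-- The bounds in terms of `N` at the order `N = ⌈(n + k)^σ⌉` are bounds of the class `E_{τ,σ}`
in terms of `n`. -/
theorem exists_pow_mul_factorial_rpow_le {τ σ : ℝ} (hτ : 0 < τ) (hσ : 1 < σ) (k : ℕ) {h : ℝ}
    (hh : 0 < h) :
    ∃ A' h' : ℝ, 1 ≤ A' ∧ 1 ≤ h' ∧ ∀ n : ℕ,
      h ^ ⌈((n + k : ℕ) : ℝ) ^ σ⌉₊ * (Nat.factorial ⌈((n + k : ℕ) : ℝ) ^ σ⌉₊ : ℝ) ^ (τ / σ) ≤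
        A' * h' ^ ((n : ℝ) ^ σ) * (n : ℝ) ^ (τ * (n : ℝ) ^ σ) := by
  obtain ⟨C, hC, hC'⟩ := exists_ceil_rpow_mul_log_le hσ k
  have hτσ : 0 < τ / σ := by positivity
  set B : ℝ := C * |Real.log h| + τ / σ * C with hB
  have hB0 : 0 ≤ B := by positivity
  set A₀ := h ^ ⌈((0 + k : ℕ) : ℝ) ^ σ⌉₊ *
    (Nat.factorial ⌈((0 + k : ℕ) : ℝ) ^ σ⌉₊ : ℝ) ^ (τ / σ)
  -- At `n = 0` the factor depending on `n` is `1`, so the constant has to exceed the value `A₀` there.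
  refine ⟨max 1 A₀, Real.exp B, le_max_left _ _, Real.one_le_exp hB0, fun n => ?_⟩
  rcases n.eq_zero_or_pos with rfl | hn
  · have h0 : ((0 : ℕ) : ℝ) ^ σ = 0 := by
      rw [Nat.cast_zero, Real.zero_rpow (by linarith)]
    simp only [h0, mul_zero, Real.rpow_zero, mul_one]
    exact le_max_right _ _
  obtain ⟨h1, h2⟩ := hC' n hn
  set N : ℕ := ⌈((n + k : ℕ) : ℝ) ^ σ⌉₊
  have hn0 : (0 : ℝ) < n := by exact_mod_cast hn
  have hf : (0 : ℝ) < N.factorial := by exact_mod_cast N.factorial_pos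
  have e1 : h ^ N ≤ Real.exp (C * |Real.log h| * (n : ℝ) ^ σ) := by
    rw [← Real.exp_log (pow_pos hh N), Real.exp_le_exp, Real.log_pow]
    calc (N : ℝ) * Real.log h ≤ N * |Real.log h| :=
          mul_le_mul_of_nonneg_left (le_abs_self _) (Nat.cast_nonneg _)
      _ ≤ C * (n : ℝ) ^ σ * |Real.log h| := mul_le_mul_of_nonneg_right h1 (abs_nonneg _)
      _ = _ := by ring
  have e2 : (N.factorial : ℝ) ^ (τ / σ) ≤
      Real.exp (τ / σ * C * (n : ℝ) ^ σ) * (n : ℝ) ^ (τ * (n : ℝ) ^ σ) := by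
    rw [Real.rpow_def_of_pos hf, Real.rpow_def_of_pos hn0 (τ * _), ← Real.exp_add, Real.exp_le_exp]
    have h3 := (log_factorial_le_mul_log N).trans h2
    have h4 := mul_le_mul_of_nonneg_right h3 hτσ.le
    have h5 : σ * (n : ℝ) ^ σ * Real.log n * (τ / σ) = Real.log n * (τ * (n : ℝ) ^ σ) := by
      field_simp
    nlinarith
  calc h ^ N * (N.factorial : ℝ) ^ (τ / σ)
      ≤ Real.exp (C * |Real.log h| * (n : ℝ) ^ σ) *
        (Real.exp (τ / σ * C * (n : ℝ) ^ σ) * (n : ℝ) ^ (τ * (n : ℝ) ^ σ)) :=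
        mul_le_mul e1 e2 (by positivity) (by positivity)
    _ = 1 * Real.exp B ^ ((n : ℝ) ^ σ) * (n : ℝ) ^ (τ * (n : ℝ) ^ σ) := by
        rw [← Real.exp_mul, hB, add_mul, Real.exp_add]; ring
    _ ≤ _ := by gcongr; exact le_max_left _ _

/-- Bounds of the class `E_{τ,σ}` at an order `n` with `n^σ ≤ c N` are bounds in terms of `N`. The
factor `Q^n` with `Q = O(N)` is harmless, because `n log N = O(N^{1/σ} log N) = O(N)`. -/
theorem exists_le_pow_mul_factorial_rpow {τ σ : ℝ} (hτ : 0 < τ) (hσ : 1 < σ) {c a h C : ℝ}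
    (hc : 0 < c) (ha : 1 ≤ a) (hh : 1 ≤ h) (hC : 1 ≤ C) :
    ∃ H : ℝ, 0 < H ∧ ∀ N n Q : ℕ, (n : ℝ) ^ σ ≤ c * N → (Q : ℝ) ≤ a * N →
      h ^ ((n : ℝ) ^ σ) * (n : ℝ) ^ (τ * (n : ℝ) ^ σ) * C ^ n * (Q : ℝ) ^ n ≤
        H ^ N * (N.factorial : ℝ) ^ (τ * c / σ) := by
  have hκ : 0 < τ * c / σ := by positivity
  have hε : 0 < 1 - 1 / σ := by
    rw [sub_pos, div_lt_one (by linarith)]; exact hσ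
  have hlh := Real.log_nonneg hh
  have hlC := Real.log_nonneg hC
  have hla := Real.log_nonneg ha
  set B : ℝ := c * Real.log h + τ * c / σ * (|Real.log c| + 1) + c * Real.log C +
    (c * Real.log a + c ^ (1 / σ) / (1 - 1 / σ)) with hB
  have hB0 : 0 ≤ B := by positivity
  refine ⟨Real.exp B, Real.exp_pos _, fun N n Q hn hQ => ?_⟩
  have hf1 : (1 : ℝ) ≤ N.factorial := by exact_mod_cast N.factorial_pos
  rcases n.eq_zero_or_pos with rfl | hn1
  · have h0 : ((0 : ℕ) : ℝ) ^ σ = 0 := by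
      rw [Nat.cast_zero, Real.zero_rpow (by linarith)]
    simp only [h0, mul_zero, Real.rpow_zero, mul_one, pow_zero]
    exact one_le_mul_of_one_le_of_one_le (one_le_pow₀ (Real.one_le_exp hB0))
      (Real.one_le_rpow hf1 hκ.le)
  have hn1' : (1 : ℝ) ≤ n := by exact_mod_cast hn1
  have hn0 : (0 : ℝ) < n := by linarith
  have hnn : (n : ℝ) ≤ (n : ℝ) ^ σ := by
    simpa using Real.rpow_le_rpow_of_exponent_le hn1' hσ.le
  have hcN : 1 ≤ c * N := hn1'.trans (hnn.trans hn)
  have hN0 : (0 : ℝ) < N := pos_of_mul_pos_right (by linarith) hc.le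
  have hN1 : (1 : ℝ) ≤ N := by exact_mod_cast Nat.cast_pos.1 hN0
  have hlN : 0 ≤ Real.log N := Real.log_nonneg hN1
  have hln : 0 ≤ Real.log n := Real.log_nonneg hn1'
  have e1 : h ^ ((n : ℝ) ^ σ) ≤ Real.exp (c * Real.log h * N) := by
    rw [Real.rpow_def_of_pos (by linarith), Real.exp_le_exp]
    have := mul_le_mul_of_nonneg_left hn hlh
    linarith
  have e2 : (n : ℝ) ^ (τ * (n : ℝ) ^ σ) ≤
      Real.exp (τ * c / σ * (|Real.log c| + 1) * N) * (N.factorial : ℝ) ^ (τ * c / σ) := by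
    rw [Real.rpow_def_of_pos hn0 (τ * _), Real.rpow_def_of_pos (by linarith) (τ * c / σ), ← Real.exp_add,
      Real.exp_le_exp]
    have h1 : σ * Real.log n ≤ |Real.log c| + Real.log N := by
      have h2 := Real.log_le_log (by positivity) hn
      rw [Real.log_rpow hn0, Real.log_mul hc.ne' hN0.ne'] at h2
      linarith [le_abs_self (Real.log c)]
    have h3 : (n : ℝ) ^ σ * (σ * Real.log n) ≤ c * N * (|Real.log c| + Real.log N) :=
      mul_le_mul hn h1 (by positivity) (by positivity)
    have h4 := mul_log_le_log_factorial_add N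
    have h5 : (n : ℝ) ^ σ * (σ * Real.log n) ≤
        c * ((|Real.log c| + 1) * N + Real.log N.factorial) := by
      refine h3.trans ?_
      rw [mul_assoc]
      refine mul_le_mul_of_nonneg_left ?_ hc.le
      linarith
    have h6 := mul_le_mul_of_nonneg_left h5 (by positivity : 0 ≤ τ / σ)
    have h7 : τ / σ * ((n : ℝ) ^ σ * (σ * Real.log n)) = Real.log n * (τ * (n : ℝ) ^ σ) := by
      field_simp
    rw [h7] at h6
    refine h6.trans_eq ?_
    ring
  have e3 : C ^ n ≤ Real.exp (c * Real.log C * N) := by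
    rw [← Real.exp_log (by positivity : 0 < C ^ n), Real.exp_le_exp, Real.log_pow]
    have := mul_le_mul_of_nonneg_right (hnn.trans hn) hlC
    linarith
  have e4 : (Q : ℝ) ^ n ≤ Real.exp ((c * Real.log a + c ^ (1 / σ) / (1 - 1 / σ)) * N) := by
    have haN : 0 < a * N := by positivity
    refine (pow_le_pow_left₀ (Nat.cast_nonneg _) hQ n).trans ?_
    rw [← Real.exp_log (pow_pos haN n), Real.exp_le_exp, Real.log_pow,
      Real.log_mul (by linarith) hN0.ne']
    have h1 : (n : ℝ) ≤ c ^ (1 / σ) * (N : ℝ) ^ (1 / σ) := by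
      rw [← Real.mul_rpow hc.le hN0.le]
      have := Real.rpow_le_rpow (by positivity) hn (by positivity : 0 ≤ 1 / σ)
      rwa [← Real.rpow_mul hn0.le, mul_one_div_cancel (by linarith), Real.rpow_one] at this
    have h2 := Real.log_le_rpow_div hN0.le hε
    have h3 : (n : ℝ) * Real.log N ≤
        c ^ (1 / σ) * (N : ℝ) ^ (1 / σ) * ((N : ℝ) ^ (1 - 1 / σ) / (1 - 1 / σ)) :=
      mul_le_mul h1 h2 hlN (by positivity)
    have h4 : (N : ℝ) ^ (1 / σ) * (N : ℝ) ^ (1 - 1 / σ) = N := by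
      rw [← Real.rpow_add hN0]; simp
    have h5 : c ^ (1 / σ) * (N : ℝ) ^ (1 / σ) * ((N : ℝ) ^ (1 - 1 / σ) / (1 - 1 / σ)) =
        c ^ (1 / σ) / (1 - 1 / σ) * N := by
      calc _ = c ^ (1 / σ) / (1 - 1 / σ) * ((N : ℝ) ^ (1 / σ) * (N : ℝ) ^ (1 - 1 / σ)) := by ring
        _ = _ := by rw [h4]
    rw [h5] at h3
    have h6 := mul_le_mul_of_nonneg_right (hnn.trans hn) hla
    linarith
  calc h ^ ((n : ℝ) ^ σ) * (n : ℝ) ^ (τ * (n : ℝ) ^ σ) * C ^ n * (Q : ℝ) ^ n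
      ≤ Real.exp (c * Real.log h * N) *
          (Real.exp (τ * c / σ * (|Real.log c| + 1) * N) * (N.factorial : ℝ) ^ (τ * c / σ)) *
          Real.exp (c * Real.log C * N) *
          Real.exp ((c * Real.log a + c ^ (1 / σ) / (1 - 1 / σ)) * N) := by gcongr
    _ = Real.exp B ^ N * (N.factorial : ℝ) ^ (τ * c / σ) := by
        have e : Real.exp B ^ N = Real.exp (c * Real.log h * N) *
            Real.exp (τ * c / σ * (|Real.log c| + 1) * N) * Real.exp (c * Real.log C * N) *
            Real.exp ((c * Real.log a + c ^ (1 / σ) / (1 - 1 / σ)) * N) := by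
          rw [← Real.exp_nat_mul, hB, ← Real.exp_add, ← Real.exp_add, ← Real.exp_add]
          congr 1
          ring
        rw [e]
        ring

/-! ### Fourier decay implies regularity -/

/-- The Fourier transforms of a bounded sequence are uniformly bounded on the unit ball, because the
exponentials with frequency in the unit ball form a bounded subset of `C^∞(U)`. -/
theorem BoundedSeq.exists_norm_fourier_le {d : ℕ} {U : Opens (Euc d)} {v : ℕ → CDistr U}
    (hv : BoundedSeq v) :
    ∃ B : ℝ, 0 ≤ B ∧ ∀ (N : ℕ) (ξ : Euc d), ‖ξ‖ ≤ 1 → ‖(v N).fourier ξ‖ ≤ B := by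
  have hS : Bornology.IsVonNBounded ℂ (SmoothFn.expFn U '' {ξ : Euc d | ‖ξ‖ ≤ 1}) := by
    refine ((SmoothFn.withSeminorms U).image_isVonNBounded_iff_seminorm_bounded _).2 fun p =>
      ⟨(2 * Real.pi) ^ p.2 + 1, by positivity, fun ξ hξ => ?_⟩
    refine (SmoothFn.seminorm_expFn_le p ξ).trans_lt (lt_add_of_le_of_pos ?_ one_pos)
    exact mul_le_of_le_one_right (by positivity) (pow_le_one₀ (norm_nonneg _) hξ)
  obtain ⟨r, hr⟩ := (NormedSpace.isVonNBounded_iff' ℂ).1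
    (ContinuousLinearMap.isVonNBounded_image2_apply hv hS)
  refine ⟨max r 0, le_max_right _ _, fun N ξ hξ => (hr _ ?_).trans (le_max_left _ _)⟩
  exact ⟨v N, ⟨N, rfl⟩, _, ⟨ξ, hξ, rfl⟩, rfl⟩

/-- The integral `∫ 2^{d+1} (1 + |ξ|)^{-(d+1)} dξ` over `ℝ^d`. -/
def decayIntegral (d : ℕ) : ℝ := ∫ ξ : Euc d, 2 ^ (d + 1) * (1 + ‖ξ‖) ^ (-((d : ℝ) + 1))

theorem integrable_decay (d : ℕ) :
    Integrable fun ξ : Euc d => (2 : ℝ) ^ (d + 1) * (1 + ‖ξ‖) ^ (-((d : ℝ) + 1)) :=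
  (integrable_one_add_norm (by simp)).const_mul _

theorem decayIntegral_nonneg (d : ℕ) : 0 ≤ decayIntegral d :=
  integral_nonneg fun _ => by positivity

/-- A function bounded by `B` on the unit ball and by `Q |ξ|^{-p}` elsewhere, with `p ≥ m + d + 1`,
has an integrable `m`-th moment, of size `O(B + Q)`. -/
theorem pow_mul_norm_le_decay {d : ℕ} {g : Euc d → ℂ} {B Q : ℝ} {m p : ℕ} (hB0 : 0 ≤ B)
    (hQ0 : 0 ≤ Q) (hB : ∀ ξ, ‖ξ‖ ≤ 1 → ‖g ξ‖ ≤ B) (hQ : ∀ ξ, ξ ≠ 0 → ‖g ξ‖ ≤ Q / ‖ξ‖ ^ p)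
    (hp : m + (d + 1) ≤ p) (ξ : Euc d) :
    ‖ξ‖ ^ m * ‖g ξ‖ ≤ (B + Q) * (2 ^ (d + 1) * (1 + ‖ξ‖) ^ (-((d : ℝ) + 1))) := by
  have h0 : (0 : ℝ) ≤ ‖ξ‖ := norm_nonneg ξ
  have e : (1 + ‖ξ‖) ^ (-((d : ℝ) + 1)) = ((1 + ‖ξ‖) ^ (d + 1))⁻¹ := by
    rw [Real.rpow_neg (by positivity)]
    congr 1
    exact_mod_cast Real.rpow_natCast (1 + ‖ξ‖) (d + 1)
  rw [e]
  have hpos : 0 < (1 + ‖ξ‖) ^ (d + 1) := by positivity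
  rcases le_total ‖ξ‖ 1 with h1 | h1
  · have h2 : (1 : ℝ) ≤ 2 ^ (d + 1) * ((1 + ‖ξ‖) ^ (d + 1))⁻¹ := by
      rw [← div_eq_mul_inv, one_le_div hpos]
      gcongr
      linarith
    calc ‖ξ‖ ^ m * ‖g ξ‖ ≤ 1 * (B + Q) :=
          mul_le_mul (pow_le_one₀ h0 h1) ((hB ξ h1).trans (by linarith)) (norm_nonneg _) zero_le_one
      _ = (B + Q) * 1 := by ring
      _ ≤ _ := mul_le_mul_of_nonneg_left h2 (by linarith)
  · have hξ : ξ ≠ 0 := fun h => by simp [h] at h1; linarith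
    have hξ0 : 0 < ‖ξ‖ := by linarith
    have h2 : ‖ξ‖ ^ m * (Q / ‖ξ‖ ^ p) ≤ Q * (‖ξ‖ ^ (d + 1))⁻¹ := by
      have h3 : ‖ξ‖ ^ m * ‖ξ‖ ^ (d + 1) ≤ ‖ξ‖ ^ p := by
        rw [← pow_add]; exact pow_le_pow_right₀ h1 hp
      rw [← div_eq_mul_inv, mul_div_assoc', div_le_div_iff₀ (by positivity) (by positivity)]
      calc ‖ξ‖ ^ m * Q * ‖ξ‖ ^ (d + 1) = Q * (‖ξ‖ ^ m * ‖ξ‖ ^ (d + 1)) := by ring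
        _ ≤ _ := mul_le_mul_of_nonneg_left h3 hQ0
    have h4 : (‖ξ‖ ^ (d + 1))⁻¹ ≤ 2 ^ (d + 1) * ((1 + ‖ξ‖) ^ (d + 1))⁻¹ := by
      rw [← div_eq_mul_inv, inv_eq_one_div, div_le_div_iff₀ (by positivity) hpos, one_mul,
        ← mul_pow]
      gcongr
      linarith
    calc ‖ξ‖ ^ m * ‖g ξ‖ ≤ ‖ξ‖ ^ m * (Q / ‖ξ‖ ^ p) :=
          mul_le_mul_of_nonneg_left (hQ ξ hξ) (by positivity)
      _ ≤ Q * (‖ξ‖ ^ (d + 1))⁻¹ := h2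
      _ ≤ (B + Q) * (2 ^ (d + 1) * ((1 + ‖ξ‖) ^ (d + 1))⁻¹) :=
          mul_le_mul (by linarith) h4 (by positivity) (by linarith)

theorem contDiff_fourierInv_and_norm_le {d m : ℕ} {g : Euc d → ℂ} (hg : Continuous g)
    (hint : ∀ j ≤ m, Integrable fun ξ => ‖ξ‖ ^ j * ‖g ξ‖) :
    ContDiff ℝ m (𝓕⁻ g) ∧
      ∀ x, ‖iteratedFDeriv ℝ m (𝓕⁻ g) x‖ ≤ (2 * Real.pi) ^ m * ∫ ξ, ‖ξ‖ ^ m * ‖g ξ‖ := by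
  have hg' : Continuous fun ξ => g (-ξ) := hg.comp continuous_neg
  have hint' : ∀ j : ℕ, (j : ℕ∞) ≤ m → Integrable fun ξ => ‖ξ‖ ^ j * ‖g (-ξ)‖ := fun j hj => by
    simpa using (hint j (by exact_mod_cast hj)).comp_neg
  rw [Real.fourierInv_eq_fourier_comp_neg]
  refine ⟨by simpa using Real.contDiff_fourier hint', fun x => ?_⟩
  rw [Real.iteratedFDeriv_fourier hint' hg'.aestronglyMeasurable le_rfl, Real.fourier_eq]
  refine (norm_integral_le_integral_norm _).trans ?_
  have e : ∫ ξ, ‖ξ‖ ^ m * ‖g ξ‖ = ∫ ξ, ‖ξ‖ ^ m * ‖g (-ξ)‖ := by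
    rw [← integral_neg_eq_self]; simp
  rw [e, ← integral_const_mul]
  refine integral_mono_of_nonneg (.of_forall fun _ => norm_nonneg _)
    ((hint' m le_rfl).const_mul _) (.of_forall fun ξ => ?_)
  simp only [Circle.norm_smul]
  refine (VectorFourier.norm_fourierPowSMulRight_le _ _ _ _).trans ?_
  have h2 : 2 * Real.pi * ‖innerSL (E := Euc d) ℝ‖ ≤ 2 * Real.pi :=
    mul_le_of_le_one_right (by positivity) (norm_innerSL_le (E := Euc d) ℝ)
  rw [← mul_assoc]
  gcongr

/-- The fundamental lemma of the calculus of variations for continuous functions, with complex test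
functions. -/
theorem eqOn_of_integral_mul_testFunction_eq {d : ℕ} {U Ω : Opens (Euc d)} (hΩ : Ω ≤ U)
    {f g : Euc d → ℂ} (hf : Continuous f) (hg : Continuous g)
    (h : ∀ φ : 𝓓(U, ℂ), tsupport φ ⊆ Ω → ∫ x, f x * φ x = ∫ x, g x * φ x) :
    Set.EqOn f g Ω := by
  have hae := Ω.isOpen.ae_eq_zero_of_integral_contDiff_smul_eq_zero (μ := volume)
    (f := fun x => f x - g x) ((hf.sub hg).locallyIntegrable.locallyIntegrableOn _)
    fun ψ hψ hc hs => by
      have hs' : tsupport (fun x => (ψ x : ℂ)) ⊆ tsupport ψ :=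
        tsupport_comp_subset (g := ((↑) : ℝ → ℂ)) Complex.ofReal_zero ψ
      let φ : 𝓓(U, ℂ) := ⟨fun x => (ψ x : ℂ), Complex.ofRealCLM.contDiff.comp hψ,
        hc.comp_left (g := ((↑) : ℝ → ℂ)) Complex.ofReal_zero, hs'.trans (hs.trans hΩ)⟩
      have hφ := h φ (hs'.trans hs)
      have hi : ∀ k : Euc d → ℂ, Continuous k → Integrable fun x => k x * φ x := fun k hk =>
        (hk.mul φ.continuous).integrable_of_hasCompactSupport φ.hasCompactSupport.mul_left
      rw [← sub_eq_zero, ← integral_sub (hi f hf) (hi g hg)] at hφ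
      rw [← hφ]
      refine integral_congr_ae (.of_forall fun x => ?_)
      change ψ x • (f x - g x) = f x * (ψ x : ℂ) - g x * (ψ x : ℂ)
      rw [Complex.real_smul]
      ring
  refine Measure.eqOn_open_of_ae_eq (μ := volume) ?_ Ω.isOpen hf.continuousOn hg.continuousOn
  refine (ae_restrict_iff' Ω.isOpen.measurableSet).2 ?_
  filter_upwards [hae] with x hx hxΩ
  exact sub_eq_zero.1 (hx hxΩ)

theorem norm_mDeriv_le {d : ℕ} (α : Fin d → ℕ) (f : Euc d → ℂ) (x : Euc d) :
    ‖mDeriv α f x‖ ≤ ‖iteratedFDeriv ℝ (mLen α) f x‖ := by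
  refine ((iteratedFDeriv ℝ (mLen α) f x).le_opNorm _).trans_eq ?_
  simp

theorem natCast_le_natCast_rpow {σ : ℝ} (hσ : 1 ≤ σ) (n : ℕ) : (n : ℝ) ≤ (n : ℝ) ^ σ := by
  rcases n.eq_zero_or_pos with rfl | hn
  · simpa using Real.zero_rpow_nonneg σ
  · simpa using Real.rpow_le_rpow_of_exponent_le (by exact_mod_cast hn : (1 : ℝ) ≤ n) hσ

/-- Fourier decay of a bounded sequence of localizations implies regularity: the derivatives of order
`n` are estimated by Fourier inversion for the single localization of order `N = ⌈(n + d + 1)^σ⌉`. -/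
theorem isRegularOn_of_fourier_decay {d : ℕ} {U : Opens (Euc d)} {τ σ : ℝ} (hτ : 0 < τ)
    (hσ : 1 < σ) {u : Distr U} {Ω : Opens (Euc d)} (hΩ : Ω ≤ U) {v : ℕ → CDistr U}
    (hv : BoundedSeq v) (hvu : ∀ N, (v N).EqOn u Ω) {A h : ℝ} (hA : 0 < A) (hh : 0 < h)
    (hdecay : ∀ (N : ℕ) (ξ : Euc d), ξ ≠ 0 → ‖(v N).fourier ξ‖ ≤
      A * (h ^ N * (N.factorial : ℝ) ^ (τ / σ) / ‖ξ‖ ^ ⌊(N : ℝ) ^ (1 / σ)⌋₊)) :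
    u.IsRegularOn τ σ Ω := by
  obtain ⟨B, hB0, hB⟩ := hv.exists_norm_fourier_le
  obtain ⟨A', h', hA', hh', hA'h'⟩ := exists_pow_mul_factorial_rpow_le hτ hσ (d + 1) hh
  set M : ℕ → ℕ := fun n => ⌈((n + (d + 1) : ℕ) : ℝ) ^ σ⌉₊ with hM
  have hσ0 : 0 < σ := by linarith
  have hMfloor : ∀ n, n + (d + 1) ≤ ⌊(M n : ℝ) ^ (1 / σ)⌋₊ := fun n => by
    refine Nat.le_floor ?_
    have h1 := Real.rpow_le_rpow (by positivity) (Nat.le_ceil (((n + (d + 1) : ℕ) : ℝ) ^ σ))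
      (by positivity : 0 ≤ 1 / σ)
    rwa [← Real.rpow_mul (Nat.cast_nonneg _), mul_one_div_cancel hσ0.ne', Real.rpow_one] at h1
  set Q : ℕ → ℝ := fun n => A * (h ^ M n * ((M n).factorial : ℝ) ^ (τ / σ)) with hQ
  have hQ0 : ∀ n, 0 ≤ Q n := fun n => by positivity
  have hpt : ∀ n, ∀ j ≤ n, ∀ ξ, ‖ξ‖ ^ j * ‖(v (M n)).fourier ξ‖ ≤
      (B + Q n) * (2 ^ (d + 1) * (1 + ‖ξ‖) ^ (-((d : ℝ) + 1))) := fun n j hj =>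
    pow_mul_norm_le_decay hB0 (hQ0 n) (hB (M n))
      (fun ξ hξ => (hdecay (M n) ξ hξ).trans_eq (mul_div_assoc _ _ _).symm)
      ((Nat.add_le_add_right hj _).trans (hMfloor n))
  have hint : ∀ n, ∀ j ≤ n, Integrable fun ξ => ‖ξ‖ ^ j * ‖(v (M n)).fourier ξ‖ := fun n j hj =>
    ((integrable_decay d).const_mul (B + Q n)).mono'
      ((continuous_norm.pow j).mul (v (M n)).continuous_fourier.norm).aestronglyMeasurable
      (.of_forall fun ξ => by
        rw [Real.norm_of_nonneg (by positivity)]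
        exact hpt n j hj ξ)
  -- `F n` represents `u` on `Ω` and is of class `C^n`; the `F n` agree on `Ω`, so `F 0` is smooth there.
  set F : ℕ → Euc d → ℂ := fun n => 𝓕⁻ (v (M n)).fourier with hF
  have hFreg := fun n => contDiff_fourierInv_and_norm_le (v (M n)).continuous_fourier (hint n)
  have hFu : ∀ n (φ : 𝓓(U, ℂ)), tsupport φ ⊆ Ω → u φ = ∫ x, F n x * φ x := fun n φ hφ => by
    rw [← hvu (M n) φ hφ]
    refine (v (M n)).apply_ofTest_eq_integral_fourierInv ?_ φ
    refine (integrable_norm_iff (v (M n)).continuous_fourier.aestronglyMeasurable).1 ?_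
    simpa using hint n 0 (Nat.zero_le n)
  have hEq : ∀ n, Set.EqOn (F 0) (F n) Ω := fun n =>
    eqOn_of_integral_mul_testFunction_eq hΩ (hFreg 0).1.continuous (hFreg n).1.continuous
      fun φ hφ => (hFu 0 φ hφ).symm.trans (hFu n φ hφ)
  have hEv : ∀ n, ∀ x ∈ Ω, F 0 =ᶠ[𝓝 x] F n := fun n x hx =>
    Filter.eventuallyEq_of_mem (Ω.isOpen.mem_nhds hx) (hEq n)
  refine ⟨F 0, ⟨?_, fun K _ hK => ?_⟩, hFu 0⟩
  · refine contDiffOn_infty.2 fun n => ?_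
    exact (hFreg n).1.contDiffOn.congr (hEq n)
  set I := decayIntegral d
  have hI : 0 ≤ I := decayIntegral_nonneg d
  refine ⟨(B + A * A') * (I + 1), 2 * Real.pi * h', by positivity, by positivity,
    fun α x hx => ?_⟩
  set n := mLen α
  have hxΩ : x ∈ Ω := hK hx
  set Y : ℝ := h' ^ ((n : ℝ) ^ σ) * (n : ℝ) ^ (τ * (n : ℝ) ^ σ) with hY
  have hY1 : 1 ≤ Y := by
    rcases n.eq_zero_or_pos with h0 | h0
    · have : (0 : ℝ) ^ σ = 0 := Real.zero_rpow hσ0.ne'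
      simp [hY, h0, this]
    · exact one_le_mul_of_one_le_of_one_le (Real.one_le_rpow hh' (by positivity))
        (Real.one_le_rpow (by exact_mod_cast h0) (by positivity))
  have h2 : ∫ ξ, ‖ξ‖ ^ n * ‖(v (M n)).fourier ξ‖ ≤ (B + Q n) * I :=
    (integral_mono (hint n n le_rfl) ((integrable_decay d).const_mul _)
      (hpt n n le_rfl)).trans_eq (integral_const_mul _ _)
  have h3 : B + Q n ≤ (B + A * A') * Y := by
    have h4 : Q n ≤ A * (A' * Y) := by
      refine mul_le_mul_of_nonneg_left ((hA'h' n).trans_eq (mul_assoc _ _ _)) hA.le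
    have h5 : B ≤ B * Y := le_mul_of_one_le_right hB0 hY1
    linarith
  have h6 : (2 * Real.pi) ^ n ≤ (2 * Real.pi) ^ ((n : ℝ) ^ σ) := by
    rw [← Real.rpow_natCast]
    exact Real.rpow_le_rpow_of_exponent_le (by linarith [Real.pi_gt_three])
      (natCast_le_natCast_rpow hσ.le n)
  calc ‖mDeriv α (F 0) x‖ ≤ ‖iteratedFDeriv ℝ n (F 0) x‖ := norm_mDeriv_le α _ x
    _ = ‖iteratedFDeriv ℝ n (F n) x‖ := by
        rw [((hEv n x hxΩ).iteratedFDeriv ℝ n).eq_of_nhds]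
    _ ≤ (2 * Real.pi) ^ n * ∫ ξ, ‖ξ‖ ^ n * ‖(v (M n)).fourier ξ‖ := (hFreg n).2 x
    _ ≤ (2 * Real.pi) ^ ((n : ℝ) ^ σ) * ((B + A * A') * Y * (I + 1)) := by
        refine mul_le_mul h6 (h2.trans ?_) (integral_nonneg fun _ => by positivity) (by positivity)
        exact mul_le_mul h3 (by linarith) hI (by positivity)
    _ = _ := by
        rw [Real.mul_rpow (x := 2 * Real.pi) (y := h') (by positivity) (by positivity), hY]
        ring

/-! ### Directional derivatives and integration by parts -/

/-- If only one coordinate direction `e` occurs in `α`, then `∂^α` is the derivative of order `|α|` in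
the direction `e`. -/
theorem mDeriv_eq_iteratedFDeriv {d n : ℕ} (α : Fin d → ℕ) (hα : mLen α = n) (e : Euc d)
    (he : ∀ i, α i ≠ 0 → EuclideanSpace.single i (1 : ℝ) = e) (f : Euc d → ℂ) (x : Euc d) :
    mDeriv α f x = iteratedFDeriv ℝ n f x fun _ => e := by
  subst hα
  refine congrArg (iteratedFDeriv ℝ (mLen α) f x) (funext fun k => he _ fun h0 => ?_)
  exact Fin.elim0 (h0 ▸ (finSigmaFinEquiv.symm k).2)

theorem mLen_single {d : ℕ} (j : Fin d) (n : ℕ) : mLen (Pi.single j n) = n := by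
  simp [mLen]

theorem mDeriv_single {d : ℕ} (j : Fin d) (n : ℕ) (f : Euc d → ℂ) (x : Euc d) :
    mDeriv (Pi.single j n) f x =
      iteratedFDeriv ℝ n f x fun _ => EuclideanSpace.single j (1 : ℝ) :=
  mDeriv_eq_iteratedFDeriv _ (mLen_single j n) _ (fun i hi => by
    by_cases h : i = j
    · rw [h]
    · exact absurd (Pi.single_eq_of_ne (M := fun _ => ℕ) h n) hi) f x

theorem mDeriv_zero {d : ℕ} (f : Euc d → ℂ) (x : Euc d) : mDeriv 0 f x = f x := by
  rw [mDeriv_eq_iteratedFDeriv (n := 0) 0 (by simp [mLen]) 0 (fun i hi => absurd rfl hi),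
    iteratedFDeriv_zero_apply]

/-- Directional derivatives are derivatives along lines. -/
theorem iteratedFDeriv_apply_const_eq_iteratedDeriv {d : ℕ} {Ω : Set (Euc d)} (hΩ : IsOpen Ω)
    {f : Euc d → ℂ} (hf : ContDiffOn ℝ ∞ f Ω) {x : Euc d} (hx : x ∈ Ω) (e : Euc d) (n : ℕ) :
    iteratedFDeriv ℝ n f x (fun _ => e) = iteratedDeriv n (fun t : ℝ => f (x + t • e)) 0 := by
  set s : Set (Euc d) := (fun y => x + y) ⁻¹' Ω
  have hs : IsOpen s := hΩ.preimage (by fun_prop)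
  have hF : ContDiffOn ℝ ∞ (fun y => f (x + y)) s :=
    hf.comp (by fun_prop) fun y hy => hy
  set ℓ : ℝ →L[ℝ] Euc d := ContinuousLinearMap.toSpanSingleton ℝ e
  have hs' : IsOpen (ℓ ⁻¹' s) := hs.preimage ℓ.continuous
  have h0 : ℓ 0 ∈ s := by simpa [s] using hx
  have key := ℓ.iteratedFDerivWithin_comp_right hF hs.uniqueDiffOn hs'.uniqueDiffOn h0
    (i := n) (by exact_mod_cast le_top)
  rw [iteratedFDerivWithin_of_isOpen n hs' h0, iteratedFDerivWithin_of_isOpen n hs h0] at key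
  have key' := congrArg (fun T => T fun _ => (1 : ℝ)) key
  rw [iteratedDeriv_eq_iteratedFDeriv]
  change _ = iteratedFDeriv ℝ n ((fun y => f (x + y)) ∘ ℓ) 0 (fun _ => (1 : ℝ))
  refine Eq.trans ?_ key'.symm
  simp [iteratedFDeriv_comp_add_left, ℓ]

/-- The Leibniz rule for the derivatives in a fixed direction. -/
theorem norm_iteratedFDeriv_mul_apply_const_le {d : ℕ} {Ω : Set (Euc d)} (hΩ : IsOpen Ω)
    {f g : Euc d → ℂ} (hf : ContDiffOn ℝ ∞ f Ω) (hg : ContDiffOn ℝ ∞ g Ω) {x : Euc d}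
    (hx : x ∈ Ω) (e : Euc d) (n : ℕ) {P Q : ℝ} (hP : 0 ≤ P)
    (hfP : ∀ k ≤ n, ‖iteratedFDeriv ℝ k f x fun _ => e‖ ≤ P)
    (hgQ : ∀ k ≤ n, ‖iteratedFDeriv ℝ k g x fun _ => e‖ ≤ Q) :
    ‖iteratedFDeriv ℝ n (fun y => f y * g y) x fun _ => e‖ ≤ 2 ^ n * (P * Q) := by
  have hline : ∀ k : Euc d → ℂ, ContDiffOn ℝ ∞ k Ω →
      ContDiffAt ℝ n (fun t : ℝ => k (x + t • e)) 0 := fun k hk => by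
    have h1 : ContDiffAt ℝ ∞ k (x + (0 : ℝ) • e) := by
      simpa using hk.contDiffAt (hΩ.mem_nhds hx)
    exact (h1.comp (0 : ℝ) (by fun_prop)).of_le (by exact_mod_cast le_top)
  rw [iteratedFDeriv_apply_const_eq_iteratedDeriv hΩ (hf.mul hg) hx e n]
  have h := iteratedDeriv_mul (hline f hf) (hline g hg)
  refine (congrArg norm h).trans_le ((norm_sum_le _ _).trans ?_)
  have h2 : (2 : ℝ) ^ n = ∑ i ∈ Finset.range (n + 1), (n.choose i : ℝ) := by
    exact_mod_cast (Nat.sum_range_choose n).symm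
  rw [h2, Finset.sum_mul]
  refine Finset.sum_le_sum fun i hi => ?_
  have hi' : i ≤ n := Nat.lt_succ_iff.1 (Finset.mem_range.1 hi)
  rw [norm_mul, norm_mul, mul_assoc, Complex.norm_natCast]
  refine mul_le_mul_of_nonneg_left ?_ (Nat.cast_nonneg _)
  refine mul_le_mul ?_ ?_ (norm_nonneg _) hP
  · rw [← iteratedFDeriv_apply_const_eq_iteratedDeriv hΩ hf hx]
    exact hfP i hi'
  · rw [← iteratedFDeriv_apply_const_eq_iteratedDeriv hΩ hg hx]
    exact hgQ (n - i) (Nat.sub_le n i)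

theorem norm_integral_le_of_support_subset {d : ℕ} {K : Set (Euc d)} (hK : IsCompact K)
    {k : Euc d → ℂ} {S : ℝ} (hk : ∀ x, x ∉ K → k x = 0) (hS : ∀ x ∈ K, ‖k x‖ ≤ S) :
    ‖∫ x, k x‖ ≤ S * (volume : Measure (Euc d)).real K := by
  rw [← setIntegral_eq_integral_of_forall_compl_eq_zero hk]
  exact norm_setIntegral_le_of_norm_le_const hK.measure_lt_top hS

/-- `n`-fold integration by parts in the direction `e`. -/
theorem pow_mul_norm_fourier_le {d : ℕ} {K : Set (Euc d)} (hK : IsCompact K) {g : Euc d → ℂ}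
    (hg : ContDiff ℝ ∞ g) (hgK : tsupport g ⊆ K) (e ξ : Euc d) (n : ℕ) {S : ℝ}
    (hS : ∀ x ∈ K, ‖iteratedFDeriv ℝ n g x fun _ => e‖ ≤ S) :
    |⟪ξ, e⟫| ^ n * ‖𝓕 g ξ‖ ≤ S * (volume : Measure (Euc d)).real K := by
  have hc : HasCompactSupport g := hK.of_isClosed_subset (isClosed_tsupport g) hgK
  have hint : ∀ m : ℕ, (m : ℕ∞) ≤ ⊤ → Integrable (iteratedFDeriv ℝ m g) := fun m _ =>
    (hg.continuous_iteratedFDeriv (by exact_mod_cast le_top)).integrable_of_hasCompactSupport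
      (hc.iteratedFDeriv m)
  have h1 := congrFun (Real.fourier_iteratedFDeriv (N := ⊤) hg hint (n := n) le_top) ξ
  have h2 := congrArg (fun T => ‖T fun _ => e‖) h1
  simp only [Real.fourier_continuousMultilinearMap_apply (hint n le_top),
    VectorFourier.fourierPowSMulRight_apply] at h2
  have h3 : ‖𝓕 (fun x => iteratedFDeriv ℝ n g x fun _ => e) ξ‖ ≤
      S * (volume : Measure (Euc d)).real K := by
    rw [Real.fourier_eq]
    refine norm_integral_le_of_support_subset hK (fun x hx => ?_) fun x hx => ?_
    · have : iteratedFDeriv ℝ n g x = 0 := by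
        by_contra h
        exact hx (hgK (support_iteratedFDeriv_subset n h))
      simp [this]
    · rw [Circle.norm_smul]
      exact hS x hx
  refine le_trans ?_ (h2.symm.trans_le h3)
  simp only [neg_apply, Finset.prod_const,
    Finset.card_univ, Fintype.card_fin, norm_smul, norm_pow, norm_neg, norm_mul, Complex.norm_I,
    Complex.norm_real, Real.norm_eq_abs, Complex.norm_ofNat, abs_of_pos Real.pi_pos, mul_one]
  refine le_mul_of_one_le_left (by positivity) (one_le_pow₀ ?_)
  linarith [Real.pi_gt_three]

/-- The largest coordinate of `ξ` controls the norm of `ξ`. -/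
theorem exists_norm_le_mul_abs_coord {d : ℕ} {ξ : Euc d} (hξ : ξ ≠ 0) :
    ∃ j : Fin d, ‖ξ‖ ≤ d * |ξ j| := by
  have hd : Nonempty (Fin d) := by
    by_contra h
    rw [not_nonempty_iff] at h
    exact hξ (Subsingleton.elim _ _)
  obtain ⟨j, hj⟩ := Finite.exists_max fun i => |ξ i|
  refine ⟨j, ?_⟩
  rw [EuclideanSpace.norm_eq]
  refine Real.sqrt_le_iff.2 ⟨by positivity, ?_⟩
  have hd1 : (1 : ℝ) ≤ d := by exact_mod_cast Fin.pos_iff_nonempty.2 hd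
  calc ∑ i, ‖ξ i‖ ^ 2 ≤ ∑ _i : Fin d, |ξ j| ^ 2 :=
        Finset.sum_le_sum fun i _ => pow_le_pow_left₀ (norm_nonneg _) (hj i) 2
    _ = d * |ξ j| ^ 2 := by simp
    _ ≤ d * (d * |ξ j| ^ 2) := le_mul_of_one_le_left (by positivity) hd1
    _ = _ := by ring

/-! ### Localizations of a regular distribution -/

section Cutoff

variable {d : ℕ} {U Ω : Opens (Euc d)} {u : Distr U} {f : Euc d → ℂ} {K : Set (Euc d)}

theorem Distr.cutoff_apply_eq_integral (hu : ∀ φ : 𝓓(U, ℂ), tsupport φ ⊆ Ω → u φ = ∫ x, f x * φ x)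
    (hKΩ : K ⊆ Ω) {χ : 𝓓(U, ℂ)} (hχ : tsupport χ ⊆ K) (e : SmoothFn U) :
    u.cutoff χ e = ∫ x, f x * (χ x * (e : Euc d → ℂ) x) := by
  refine hu (SmoothFn.mulTest χ e) ?_
  exact (tsupport_mul_subset_left (f := χ) (g := (e : Euc d → ℂ))).trans (hχ.trans hKΩ)

theorem contDiff_mul_testFunction (hf : ContDiffOn ℝ ∞ f Ω) {χ : 𝓓(U, ℂ)} (hχ : tsupport χ ⊆ Ω) :
    ContDiff ℝ ∞ fun x => f x * χ x := by
  rw [contDiff_iff_contDiffAt]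
  intro x
  by_cases hx : x ∈ Ω
  · exact (hf.contDiffAt (Ω.isOpen.mem_nhds hx)).mul χ.contDiff.contDiffAt
  · refine (contDiffAt_const (c := (0 : ℂ))).congr_of_eventuallyEq ?_
    filter_upwards [notMem_tsupport_iff_eventuallyEq.1 fun h => hx (hχ h)] with y hy
    simp [hy]

/-- The localization `χ u` of a distribution given by `f` near the support of `χ` has the Fourier
transform of the function `f χ`. -/
theorem Distr.fourier_cutoff_eq
    (hu : ∀ φ : 𝓓(U, ℂ), tsupport φ ⊆ Ω → u φ = ∫ x, f x * φ x)
    (hKΩ : K ⊆ Ω) {χ : 𝓓(U, ℂ)} (hχ : tsupport χ ⊆ K) (ξ : Euc d) :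
    (u.cutoff χ).fourier ξ = 𝓕 (fun x => f x * χ x) ξ := by
  rw [CDistr.fourier, Distr.cutoff_apply_eq_integral hu hKΩ hχ, Real.fourier_eq']
  refine integral_congr_ae (.of_forall fun x => ?_)
  by_cases hx : x ∈ (U : Set (Euc d))
  · have e : (SmoothFn.expFn U ξ : Euc d → ℂ) x =
        Complex.exp (-(2 * Real.pi * inner ℝ x ξ : ℝ) * Complex.I) :=
      Set.indicator_of_mem hx fun y => Complex.exp (-(2 * Real.pi * inner ℝ y ξ : ℝ) * Complex.I)
    simp only [e, smul_eq_mul]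
    push_cast
    ring_nf
  · have : χ x = 0 := image_eq_zero_of_notMem_tsupport fun h => hx (χ.tsupport_subset h)
    simp [this]

/-- Multiplication of a continuous function by uniformly bounded cut-off functions yields a bounded
sequence. -/
theorem boundedSeq_cutoff (hf : ContDiffOn ℝ ∞ f Ω)
    (hu : ∀ φ : 𝓓(U, ℂ), tsupport φ ⊆ Ω → u φ = ∫ x, f x * φ x) (hK : IsCompact K)
    (hKΩ : K ⊆ Ω) (hKU : K ⊆ U) {χ : ℕ → 𝓓(U, ℂ)} (hχ : ∀ N, tsupport (χ N) ⊆ K) {C : ℝ}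
    (hC : ∀ N, ∀ x ∈ K, ‖χ N x‖ ≤ C) :
    BoundedSeq fun N => u.cutoff (χ N) := by
  refine ContinuousLinearMap.isVonNBounded_iff.2 fun S hS => ?_
  obtain ⟨r, -, hr⟩ := (SmoothFn.withSeminorms U).isVonNBounded_iff_seminorm_bounded.1 hS
    (⟨⟨K, hK⟩, hKU⟩, 0)
  obtain ⟨M, hM⟩ := hK.exists_bound_of_continuousOn (hf.continuousOn.mono hKΩ)
  refine (NormedSpace.isVonNBounded_iff' ℂ).2
    ⟨|M| * (|C| * r) * (volume : Measure (Euc d)).real K, ?_⟩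
  rintro _ ⟨_, ⟨N, rfl⟩, g, hg, rfl⟩
  change ‖u.cutoff (χ N) g‖ ≤ _
  rw [Distr.cutoff_apply_eq_integral hu hKΩ (hχ N)]
  refine norm_integral_le_of_support_subset hK (fun x hx => ?_) fun x hx => ?_
  · simp [image_eq_zero_of_notMem_tsupport fun h => hx (hχ N h)]
  · rw [norm_mul, norm_mul]
    have h1 : ‖(g : Euc d → ℂ) x‖ ≤ r := by
      rw [← norm_iteratedFDeriv_zero (𝕜 := ℝ)]
      exact (SmoothFn.le_seminorm g (L := ⟨K, hK⟩) hKU 0 hx).trans (hr g hg).le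
    have h2 := (hC N x hx).trans (le_abs_self C)
    have h3 := (hM x hx).trans (le_abs_self M)
    gcongr

theorem Distr.cutoff_eqOn {χ : 𝓓(U, ℂ)} {W : Opens (Euc d)} (hχ : ∀ x ∈ W, χ x = 1) :
    (u.cutoff χ).EqOn u W := by
  intro φ hφ
  refine congrArg u (DFunLike.ext _ _ fun x => ?_)
  change χ x * φ x = φ x
  by_cases hx : x ∈ W
  · rw [hχ x hx, one_mul]
  · rw [image_eq_zero_of_notMem_tsupport fun h => hx (hφ h), mul_zero]

end Cutoff

/-- The bounds of the class `E_{τ,σ}` increase with the order, once the base is at least `1`. -/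
theorem rpow_mul_self_rpow_le {τ σ : ℝ} (hτ : 0 < τ) (hσ : 0 < σ) {h h' : ℝ} (hh : 0 < h)
    (hh' : h ≤ h') (hh1 : 1 ≤ h') {k n : ℕ} (hkn : k ≤ n) :
    h ^ ((k : ℝ) ^ σ) * (k : ℝ) ^ (τ * (k : ℝ) ^ σ) ≤
      h' ^ ((n : ℝ) ^ σ) * (n : ℝ) ^ (τ * (n : ℝ) ^ σ) := by
  have hkn' : (k : ℝ) ≤ n := by exact_mod_cast hkn
  have h1 : (k : ℝ) ^ σ ≤ (n : ℝ) ^ σ := Real.rpow_le_rpow (Nat.cast_nonneg _) hkn' hσ.le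
  have h2 : h ^ ((k : ℝ) ^ σ) ≤ h' ^ ((n : ℝ) ^ σ) :=
    (Real.rpow_le_rpow hh.le hh' (by positivity)).trans
      (Real.rpow_le_rpow_of_exponent_le hh1 h1)
  refine mul_le_mul h2 ?_ (by positivity) (by positivity)
  rcases n.eq_zero_or_pos with hn | hn
  · have hk : k = 0 := by omega
    rw [hk, hn]
  · have hn1 : (1 : ℝ) ≤ n := by exact_mod_cast hn
    exact (Real.rpow_le_rpow (Nat.cast_nonneg _) hkn' (by positivity)).trans
      (Real.rpow_le_rpow_of_exponent_le hn1 (by gcongr))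

/-- The estimate of the Fourier transforms of the localizations before it is expressed in terms
of `N`: integration by parts of an arbitrary order `n` at which the cut-off function is
controlled. -/
theorem exists_pow_mul_norm_fourier_cutoff_le {d : ℕ} {U Ω : Opens (Euc d)} {u : Distr U}
    {f : Euc d → ℂ} {K W : Set (Euc d)} {τ τ' σ : ℝ} (hτ : 0 < τ) (hσ : 0 < σ)
    (hf : IsRegularFun τ σ Ω f)
    (hu : ∀ φ : 𝓓(U, ℂ), tsupport φ ⊆ Ω → u φ = ∫ x, f x * φ x) (hKΩ : K ⊆ Ω)
    {χ : ℕ → 𝓓(U, ℂ)} (hχ : IsAdmissible τ' σ W K χ) :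
    ∃ A h C : ℝ, 0 < A ∧ 1 ≤ h ∧ 1 ≤ C ∧ ∀ (M n : ℕ), n ≤ ⌊((M : ℝ) / τ') ^ (1 / σ)⌋₊ →
      ∀ ξ : Euc d, ξ ≠ 0 → ‖ξ‖ ^ n * ‖(u.cutoff (χ M)).fourier ξ‖ ≤
        A * (h ^ ((n : ℝ) ^ σ) * (n : ℝ) ^ (τ * (n : ℝ) ^ σ) * C ^ n *
          (⌊(M : ℝ) ^ (1 / σ)⌋₊ : ℝ) ^ n) := by
  obtain ⟨A, h, hA, hh, hAh⟩ := hf.2 K hχ.isCompact hKΩ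
  obtain ⟨C, hC0, hC⟩ := hχ.bound
  set h₁ := max h 1
  set C₁ := max (C 0) 1
  have hC₁ : 1 ≤ C₁ := le_max_right _ _
  have hh₁ : 1 ≤ h₁ := le_max_right _ _
  set V := (volume : Measure (Euc d)).real K
  have hV : 0 ≤ V := measureReal_nonneg
  refine ⟨A * C₁ * (V + 1), h₁, 2 * (d + 1) * C₁, by positivity, hh₁, ?_, fun M n hn ξ hξ => ?_⟩
  · have : (0 : ℝ) ≤ d := Nat.cast_nonneg d
    nlinarith
  obtain ⟨j, hj⟩ := exists_norm_le_mul_abs_coord hξ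
  set e : Euc d := EuclideanSpace.single j (1 : ℝ)
  set q : ℕ := ⌊(M : ℝ) ^ (1 / σ)⌋₊
  set P : ℝ := A * (h₁ ^ ((n : ℝ) ^ σ) * (n : ℝ) ^ (τ * (n : ℝ) ^ σ))
  have hP : 0 ≤ P := by positivity
  -- For `M = 0` only the order `n = 0` occurs; otherwise `q ≥ 1` and the powers of `q` increase.
  have hq : ∀ k ≤ n, (q : ℝ) ^ k ≤ (q : ℝ) ^ n := fun k hk => by
    rcases M.eq_zero_or_pos with rfl | hM
    · have h0 : ((0 : ℕ) / τ' : ℝ) ^ (1 / σ) = 0 := by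
        rw [Nat.cast_zero, zero_div, Real.zero_rpow (by positivity)]
      rw [h0, Nat.floor_zero] at hn
      have hk0 : k = n := by omega
      rw [hk0]
    · have : 1 ≤ q := Nat.le_floor (by
        rw [Nat.cast_one]
        exact Real.one_le_rpow (by exact_mod_cast hM) (by positivity))
      exact pow_le_pow_right₀ (by exact_mod_cast this) hk
  have hfP : ∀ x ∈ K, ∀ k ≤ n, ‖iteratedFDeriv ℝ k f x fun _ => e‖ ≤ P := fun x hx k hk => by
    have h1 := hAh (Pi.single j k) x hx
    rw [mDeriv_single, mLen_single, mul_assoc] at h1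
    exact h1.trans (mul_le_mul_of_nonneg_left
      (rpow_mul_self_rpow_le hτ hσ hh (le_max_left _ _) hh₁ hk) hA.le)
  have hχQ : ∀ x ∈ K, ∀ k ≤ n,
      ‖iteratedFDeriv ℝ k (χ M) x fun _ => e‖ ≤ C₁ ^ (n + 1) * (q : ℝ) ^ n := fun x hx k hk => by
    have h1 := hC M (Pi.single j k) 0 (by rw [mLen_single]; exact hk.trans hn) x hx
    rw [add_zero, mDeriv_single, mLen_single] at h1
    refine h1.trans (mul_le_mul ?_ (hq k hk) (by positivity) (by positivity))
    refine (pow_le_pow_left₀ (hC0 0).le (le_max_left _ _) _).trans (pow_le_pow_right₀ hC₁ (by omega))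
  have hS : ∀ x ∈ K, ‖iteratedFDeriv ℝ n (fun y => f y * χ M y) x fun _ => e‖ ≤
      2 ^ n * (P * (C₁ ^ (n + 1) * (q : ℝ) ^ n)) := fun x hx =>
    norm_iteratedFDeriv_mul_apply_const_le Ω.isOpen hf.1 (χ M).contDiff.contDiffOn (hKΩ hx) e n hP
      (hfP x hx) (hχQ x hx)
  have key := pow_mul_norm_fourier_le hχ.isCompact
    (contDiff_mul_testFunction hf.1 ((hχ.tsupport_subset M).trans hKΩ))
    ((tsupport_mul_subset_right (f := f) (g := χ M)).trans (hχ.tsupport_subset M)) e ξ n hS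
  rw [← Distr.fourier_cutoff_eq hu hKΩ (hχ.tsupport_subset M)] at key
  have he : ⟪ξ, e⟫ = ξ j := by
    rw [EuclideanSpace.inner_single_right]
    simp
  rw [he] at key
  have hd : (d : ℝ) ^ n ≤ (d + 1 : ℝ) ^ n := by gcongr; linarith
  calc ‖ξ‖ ^ n * ‖(u.cutoff (χ M)).fourier ξ‖
      ≤ (d * |ξ j|) ^ n * ‖(u.cutoff (χ M)).fourier ξ‖ := by gcongr
    _ = d ^ n * (|ξ j| ^ n * ‖(u.cutoff (χ M)).fourier ξ‖) := by ring
    _ ≤ (d + 1) ^ n * (2 ^ n * (P * (C₁ ^ (n + 1) * (q : ℝ) ^ n)) * (V + 1)) := by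
        refine mul_le_mul hd (key.trans ?_) (by positivity) (by positivity)
        exact mul_le_mul_of_nonneg_left (by linarith) (by positivity)
    _ = _ := by
        rw [mul_pow, mul_pow]
        ring

/-- The estimate of the localizations along a choice of cut-off functions `χ_{M(N)}` and of orders
`n(N)`, with `n(N)^σ ≤ c N`; the ratio `c` determines the power of `N!`. -/
theorem exists_norm_fourier_cutoff_le {d : ℕ} {U Ω : Opens (Euc d)} {u : Distr U}
    {f : Euc d → ℂ} {K W : Set (Euc d)} {τ τ' σ c a : ℝ} (hτ : 0 < τ) (hσ : 1 < σ)
    (hf : IsRegularFun τ σ Ω f)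
    (hu : ∀ φ : 𝓓(U, ℂ), tsupport φ ⊆ Ω → u φ = ∫ x, f x * φ x) (hKΩ : K ⊆ Ω)
    {χ : ℕ → 𝓓(U, ℂ)} (hχ : IsAdmissible τ' σ W K χ) (hc : 0 < c) (ha : 1 ≤ a)
    (M n : ℕ → ℕ) (hn : ∀ N, n N ≤ ⌊((M N : ℝ) / τ') ^ (1 / σ)⌋₊)
    (hnc : ∀ N, (n N : ℝ) ^ σ ≤ c * N)
    (hMa : ∀ N, (⌊(M N : ℝ) ^ (1 / σ)⌋₊ : ℝ) ≤ a * N) :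
    ∃ A h : ℝ, 0 < A ∧ 0 < h ∧ ∀ (N : ℕ) (ξ : Euc d), ξ ≠ 0 →
      ‖(u.cutoff (χ (M N))).fourier ξ‖ ≤
        A * (h ^ N * (N.factorial : ℝ) ^ (τ * c / σ) / ‖ξ‖ ^ n N) := by
  obtain ⟨A, h, C, hA, hh, hC, hAhC⟩ :=
    exists_pow_mul_norm_fourier_cutoff_le hτ (by linarith) hf hu hKΩ hχ
  obtain ⟨H, hH, hHle⟩ := exists_le_pow_mul_factorial_rpow hτ hσ hc ha hh hC
  refine ⟨A, H, hA, hH, fun N ξ hξ => ?_⟩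
  have h1 := (hAhC (M N) (n N) (hn N) ξ hξ).trans
    (mul_le_mul_of_nonneg_left (hHle N (n N) _ (hnc N) (hMa N)) hA.le)
  rw [mul_div_assoc', le_div_iff₀ (by positivity)]
  linarith

theorem floor_rpow_rpow_le {σ x : ℝ} (hσ : 0 < σ) (hx : 0 ≤ x) :
    (⌊x ^ (1 / σ)⌋₊ : ℝ) ^ σ ≤ x := by
  refine (Real.rpow_le_rpow (Nat.cast_nonneg _) (Nat.floor_le (by positivity)) hσ.le).trans_eq ?_
  rw [← Real.rpow_mul hx, one_div_mul_cancel hσ.ne', Real.rpow_one]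

theorem floor_natCast_rpow_le {σ : ℝ} (hσ : 1 ≤ σ) (N : ℕ) :
    (⌊(N : ℝ) ^ (1 / σ)⌋₊ : ℝ) ≤ N :=
  (natCast_le_natCast_rpow hσ _).trans (floor_rpow_rpow_le (by linarith) (Nat.cast_nonneg _))

end

theorem mainTheorem4 (d : ℕ) (U : Opens (Euc d)) (τ σ : ℝ) (hτ : 0 < τ) (hσ : 1 < σ)
    (u : Distr U) (Ω : Opens (Euc d)) (hΩ : Ω ≤ U) :
    -- sufficiency
    (∀ v : ℕ → CDistr U, BoundedSeq v → (∀ N, (v N).EqOn u Ω) →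
      (∃ A h : ℝ, 0 < A ∧ 0 < h ∧ ∀ (N : ℕ) (ξ : Euc d), ξ ≠ 0 →
        ‖(v N).fourier ξ‖ ≤
          A * (h ^ N * (N.factorial : ℝ) ^ (τ / σ) / ‖ξ‖ ^ ⌊(N : ℝ) ^ (1 / σ)⌋₊)) →
      u.IsRegularOn τ σ Ω) ∧
    -- necessity, for a cut-off sequence admissible with respect to a compact subset of `Ω`
    (u.IsRegularOn τ σ Ω → ∀ τ' : ℝ, τ' = τ ^ (σ / (σ - 1)) →
      ∀ (W : Opens (Euc d)) (K : Set (Euc d)) (χ : ℕ → 𝓓(U, ℂ)), K ⊆ Ω →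
        IsAdmissible τ' σ W K χ →
        BoundedSeq (fun N => u.cutoff (χ N)) ∧
        (∀ N, (u.cutoff (χ N)).EqOn u W) ∧
        (∃ A h : ℝ, 0 < A ∧ 0 < h ∧ ∀ (N : ℕ) (ξ : Euc d), ξ ≠ 0 →
          ‖(u.cutoff (χ N)).fourier ξ‖ ≤
            A * (h ^ N * (N.factorial : ℝ) ^ (τ' ^ (-1 / σ) / σ) /
              ‖ξ‖ ^ ⌊((N : ℝ) / τ') ^ (1 / σ)⌋₊)) ∧
        (∃ A h : ℝ, 0 < A ∧ 0 < h ∧ ∀ (N : ℕ) (ξ : Euc d), ξ ≠ 0 →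
          ‖(u.cutoff (χ ⌈τ' * N⌉₊)).fourier ξ‖ ≤
            A * (h ^ N * (N.factorial : ℝ) ^ (τ / σ) /
              ‖ξ‖ ^ ⌊(N : ℝ) ^ (1 / σ)⌋₊))) := by
  have hσ0 : 0 < σ := by linarith
  refine ⟨fun v hv hvu ⟨A, h, hA, hh, hdecay⟩ =>
    isRegularOn_of_fourier_decay hτ hσ hΩ hv hvu hA hh hdecay, ?_⟩
  rintro ⟨f, hf, hu⟩ τ' rfl W K χ hKΩ hχ
  set τ' := τ ^ (σ / (σ - 1)) with hτ'
  have hτ'0 : 0 < τ' := by positivity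
  -- The exponents match because `τ / τ' = τ ^ (-1 / (σ - 1)) = τ' ^ (-1 / σ)`.
  have hexp : τ * (1 / τ') / σ = τ' ^ (-1 / σ) / σ := by
    congr 1
    have hσ1 : σ - 1 ≠ 0 := by linarith
    rw [hτ', ← Real.rpow_mul hτ.le, mul_one_div]
    nth_rewrite 1 [← Real.rpow_one τ]
    rw [← Real.rpow_sub hτ]
    congr 1
    field_simp
    ring
  refine ⟨?_, fun N => Distr.cutoff_eqOn fun x hx => (hχ.eq_one N).self_of_nhdsSet x hx, ?_, ?_⟩
  · obtain ⟨C, -, hC⟩ := hχ.bound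
    refine boundedSeq_cutoff hf.1 hu hχ.isCompact hKΩ hχ.subset hχ.tsupport_subset (C := C 0)
      fun N x hx => ?_
    have h := hC N 0 0 (by simp [mLen]) x hx
    simpa [mDeriv_zero, mLen] using h
  · rw [← hexp]
    refine exists_norm_fourier_cutoff_le hτ hσ hf hu hKΩ hχ (by positivity) le_rfl (fun N => N)
      (fun N => ⌊((N : ℝ) / τ') ^ (1 / σ)⌋₊) (fun N => le_rfl) (fun N => ?_) fun N => ?_
    · refine (floor_rpow_rpow_le hσ0 (by positivity)).trans_eq ?_
      rw [div_eq_inv_mul, one_div]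
    · simpa using floor_natCast_rpow_le hσ.le N
  · have h := exists_norm_fourier_cutoff_le hτ hσ hf hu hKΩ hχ one_pos
      (by linarith : 1 ≤ τ' + 1) (fun N => ⌈τ' * N⌉₊) (fun N => ⌊(N : ℝ) ^ (1 / σ)⌋₊)
      (fun N => ?_) (fun N => ?_) fun N => ?_
    · simpa using h
    · refine Nat.floor_mono (Real.rpow_le_rpow (Nat.cast_nonneg _) ?_ (by positivity))
      rw [le_div_iff₀ hτ'0, mul_comm]
      exact Nat.le_ceil _
    · simpa using floor_rpow_rpow_le hσ0 (Nat.cast_nonneg N)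
    · refine (floor_natCast_rpow_le hσ.le _).trans ?_
      rcases N.eq_zero_or_pos with rfl | hN
      · simp
      · have h1 : (1 : ℝ) ≤ N := by exact_mod_cast hN
        have h2 := Nat.ceil_lt_add_one (by positivity : 0 ≤ τ' * N)
        linarith
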